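/- Let $G$ be a group and let $\mathcal G(G)$ be the set of generating sets of $G$ modulo the equivalence relation associated with the preorder $X\preceq Y$, which means that the identity map $(G,d_Y)\to(G,d_X)$ between the word metrics is Lipschitz; $\mathcal G(G)$ is partially ordered by $[X]\preccurlyeq[Y]\iff X\preceq Y$. Let $\mathcal H(G)\subseteq\mathcal G(G)$ be the set of hyperbolic structures, i.e. of classes $[X]$ such that the Cayley graph $\Gamma(G,X)$ is (Gromov) hyperbolic. Let $\partial\Gamma(G,X)$ be the Gromov boundary (equivalence classes of sequences converging at infinity), on which $G$ acts. A structure $[X]\in\mathcal H(G)$ is elliptic if $|\partial\Gamma(G,X)|=0$; lineal if $|\partial\Gamma(G,X)|=2$; orientable lineal if it is lineal and $G$ fixes both points of $\partial\Gamma(G,X)$; quasi-parabolic if $\partial\Gamma(G,X)$ is infinite and $G$ fixes a point of it; of general type if $\partial\Gamma(G,X)$ is infinite and $G$ fixes no point of it. The corresponding sets are denoted by $\mathcal H_e(G)$, $\mathcal H_\ell(G)$, $\mathcal H_\ell^+(G)$, $\mathcal H_{qp}(G)$, $\mathcal H_{gt}(G)$. (a) For every group $G$, every element of $\mathcal H_\ell(G)$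 is a minimal element of $\mathcal H(G)\setminus\mathcal H_e(G)$. Moreover $\mathcal H_\ell(G)$ is an antichain, and so is $\mathcal H_\ell^+(G)$. (b) For every group $G$, the cardinality of $\mathcal H_\ell^+(G)$ is $0$, $1$, or at least $2^{\aleph_0}$. (c) For every cardinal $\kappa$, the direct sum $G_\kappa$ of $\kappa$ copies of the infinite dihedral group satisfies $$|\mathcal H_\ell(G_\kappa)|=\kappa\quad\text{and}\quad \mathcal H_\ell^+(G_\kappa)=\mathcal H_{qp}(G_\kappa)=\mathcal H_{gt}(G_\kappa)=\emptyset .$$ Moreover $G_\kappa$ is generated by a subset of cardinality at most $2\kappa$; thus it is generated by a subset of cardinality at most $\kappa$ if $\kappa$ is infinite, and it is finitely generated if $\kappa$ is finite. -/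

import Mathlib

universe u

namespace HypStr

/-! ### Hyperbolic graphs and their Gromov boundaries

A connected graph is regarded as a metric space through the combinatorial distance
`SimpleGraph.dist` on its vertices; edges have length one. -/

section Graph

variable {V : Type u} (Γ : SimpleGraph V)

/-- A walk is geodesic if its length is the distance between its endpoints. -/
def IsGeodesicWalk {x y : V} (p : Γ.Walk x y) : Prop := p.length = Γ.dist x y

/-- Rips hyperbolicity of a graph: it is connected and, for some `δ`, each side of every geodesic
triangle lies in the union of the closed `δ`-neighbourhoods of the other two sides. (Triangles are
taken with corners at vertices; allowing corners and points inside the edges changes only the value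
of `δ`. As `x, y, z` are arbitrary and geodesics can be reversed, it is enough to write the
condition for one side.) -/
def IsHyperbolicGraph : Prop :=
  Γ.Connected ∧ ∃ δ : ℕ, ∀ (x y z : V) (p : Γ.Walk x y) (q : Γ.Walk y z) (r : Γ.Walk z x),
    IsGeodesicWalk Γ p → IsGeodesicWalk Γ q → IsGeodesicWalk Γ r →
      ∀ a ∈ p.support, ∃ b, (b ∈ q.support ∨ b ∈ r.support) ∧ Γ.dist a b ≤ δ

/-- The Gromov product `(x | y)_s = (d(x,s) + d(y,s) - d(x,y)) / 2`. -/
noncomputable def gromovProduct (s x y : V) : ℝ :=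
  ((Γ.dist x s : ℝ) + (Γ.dist y s : ℝ) - (Γ.dist x y : ℝ)) / 2

/-- `(x_i | y_j)_s → ∞` as `i, j → ∞`, for every base point `s` (in a connected graph this does
not depend on `s`). -/
def Fellow (x y : ℕ → V) : Prop :=
  ∀ s : V, Filter.Tendsto (fun ij : ℕ × ℕ => gromovProduct Γ s (x ij.1) (y ij.2))
    Filter.atTop Filter.atTop

/-- Sequences that converge at infinity: `(x_i | x_j)_s → ∞` as `i, j → ∞`. -/
def SeqAtInfinity : Type u := {x : ℕ → V // Fellow Γ x x}

/-- The Gromov boundary: sequences converging at infinity, where `x` and `y` are identified when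
`(x_i | y_j)_s → ∞` as `i, j → ∞` (an equivalence relation if the graph is hyperbolic). -/
def Boundary : Type u := Quot (fun x y : SeqAtInfinity Γ => Fellow Γ x.1 y.1)

end Graph

/-! ### The action of a group on the boundary of its Cayley graph

`SimpleGraph.mulCayley X` is the Cayley graph `Γ(G, X)`: distinct `g, h` are adjacent if and only if
`g⁻¹ * h` is in `X ∪ X⁻¹`. The group acts on it by left multiplication. -/

section Cayley

variable {G : Type u} [Group G] (X : Set G)

/-- Left multiplication as an automorphism of the Cayley graph. -/
def leftMulIso (g : G) : SimpleGraph.mulCayley X ≃g SimpleGraph.mulCayley X where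
  toEquiv := Equiv.mulLeft g
  map_rel_iff' := by
    intro a b
    simp

theorem edist_le_of_hom {V : Type u} {Γ : SimpleGraph V} (f : Γ →g Γ) (a b : V) :
    Γ.edist (f a) (f b) ≤ Γ.edist a b := by
  by_cases h : Γ.Reachable a b
  · obtain ⟨w, hw⟩ := h.exists_walk_length_eq_edist
    rw [← hw, ← SimpleGraph.Walk.length_map f w]
    exact SimpleGraph.edist_le _
  · rw [SimpleGraph.edist_eq_top_of_not_reachable h]
    exact le_top

/-- The word metric is invariant under left multiplication. -/
theorem dist_mul_left (g a b : G) :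
    (SimpleGraph.mulCayley X).dist (g * a) (g * b) = (SimpleGraph.mulCayley X).dist a b := by
  have key : ∀ g a b : G, (SimpleGraph.mulCayley X).edist (g * a) (g * b)
      ≤ (SimpleGraph.mulCayley X).edist a b :=
    fun g a b => edist_le_of_hom (leftMulIso X g).toHom a b
  have h : (SimpleGraph.mulCayley X).edist (g * a) (g * b)
      = (SimpleGraph.mulCayley X).edist a b := by
    refine le_antisymm (key g a b) ?_
    simpa using key g⁻¹ (g * a) (g * b)
  unfold SimpleGraph.dist
  rw [h]

theorem fellow_mul_left (g : G) {x y : ℕ → G} (h : Fellow (SimpleGraph.mulCayley X) x y) :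
    Fellow (SimpleGraph.mulCayley X) (fun n => g * x n) (fun n => g * y n) := by
  intro s
  refine (h (g⁻¹ * s)).congr fun ij => ?_
  have hs : ∀ a : G, (SimpleGraph.mulCayley X).dist (g * a) s
      = (SimpleGraph.mulCayley X).dist a (g⁻¹ * s) := by
    intro a
    have := dist_mul_left X g a (g⁻¹ * s)
    simpa using this
  simp only [gromovProduct, hs, dist_mul_left]

/-- The action of `G` on `∂Γ(G, X)`, induced by left multiplication of sequences. -/
instance : SMul G (Boundary (SimpleGraph.mulCayley X)) where
  smul g := Quot.map (fun x => ⟨fun n => g * x.1 n, fellow_mul_left X g x.2⟩)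
    (fun _ _ h => fellow_mul_left X g h)

instance : MulAction G (Boundary (SimpleGraph.mulCayley X)) where
  one_smul := by
    rintro ⟨x, hx⟩
    refine congrArg (Quot.mk _) (Subtype.ext ?_)
    funext n
    exact one_mul _
  mul_smul := by
    rintro g h ⟨x, hx⟩
    refine congrArg (Quot.mk _) (Subtype.ext ?_)
    funext n
    exact mul_assoc _ _ _

end Cayley

/-! ### The posets of generating sets and of hyperbolic structures -/

section Structures

variable (G : Type u) [Group G]

/-- The generating sets of `G`. -/
def GenSet : Type u := {X : Set G // Subgroup.closure X = ⊤}

variable {G} in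
/-- The Cayley graph of `G` with respect to a generating set. -/
def GenSet.cayley (X : GenSet G) : SimpleGraph G := SimpleGraph.mulCayley X.1

variable {G} in
/-- The action of `G` on `∂Γ(G, X)`. -/
instance (X : GenSet G) : MulAction G (Boundary X.cayley) :=
  inferInstanceAs (MulAction G (Boundary (SimpleGraph.mulCayley X.1)))

/-- `X ≤ Y` (`X` is dominated by `Y`) if the identity map `(G, d_Y) → (G, d_X)` is Lipschitz. -/
instance : Preorder (GenSet G) where
  le X Y := ∃ C : ℕ, ∀ g h : G, X.cayley.dist g h ≤ C * Y.cayley.dist g h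
  le_refl X := ⟨1, fun g h => by simp⟩
  le_trans X Y Z := by
    rintro ⟨C, hC⟩ ⟨D, hD⟩
    refine ⟨C * D, fun g h => (hC g h).trans ?_⟩
    rw [mul_assoc]
    exact Nat.mul_le_mul_left C (hD g h)

/-- The poset `𝒢(G)` of generating sets modulo the equivalence `X ≤ Y ∧ Y ≤ X`. -/
abbrev GenClass : Type u := Antisymmetrization (GenSet G) (· ≤ ·)

variable {G} in
/-- The class `[X]` of a generating set. -/
abbrev GenSet.toClass (X : GenSet G) : GenClass G := toAntisymmetrization (· ≤ ·) X

/-- `ℋ(G)`: classes `[X]` such that `Γ(G, X)` is hyperbolic. -/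
def hyperbolicStructures : Set (GenClass G) :=
  {A | ∃ X : GenSet G, X.toClass = A ∧ IsHyperbolicGraph X.cayley}

/-- `ℋ_e(G)`: the boundary is empty. -/
def ellipticStructures : Set (GenClass G) :=
  {A | ∃ X : GenSet G, X.toClass = A ∧ IsHyperbolicGraph X.cayley ∧ IsEmpty (Boundary X.cayley)}

/-- `ℋ_ℓ(G)`: the boundary has exactly two points. -/
def linealStructures : Set (GenClass G) :=
  {A | ∃ X : GenSet G, X.toClass = A ∧ IsHyperbolicGraph X.cayley ∧
    Nat.card (Boundary X.cayley) = 2}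

/-- `ℋ_ℓ⁺(G)`: the boundary has exactly two points and `G` fixes both. -/
def orientableLinealStructures : Set (GenClass G) :=
  {A | ∃ X : GenSet G, X.toClass = A ∧ IsHyperbolicGraph X.cayley ∧
    Nat.card (Boundary X.cayley) = 2 ∧ ∀ (g : G) (ξ : Boundary X.cayley), g • ξ = ξ}

/-- `ℋ_qp(G)`: the boundary is infinite and `G` fixes a point of it. -/
def quasiParabolicStructures : Set (GenClass G) :=
  {A | ∃ X : GenSet G, X.toClass = A ∧ IsHyperbolicGraph X.cayley ∧
    Infinite (Boundary X.cayley) ∧ ∃ ξ : Boundary X.cayley, ∀ g : G, g • ξ = ξ}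

/-- `ℋ_gt(G)`: the boundary is infinite and `G` fixes no point of it. -/
def generalTypeStructures : Set (GenClass G) :=
  {A | ∃ X : GenSet G, X.toClass = A ∧ IsHyperbolicGraph X.cayley ∧
    Infinite (Boundary X.cayley) ∧ ¬ ∃ ξ : Boundary X.cayley, ∀ g : G, g • ξ = ξ}

/-- A minimal hyperbolic structure is a minimal element of `ℋ(G) \ ℋ_e(G)`. -/
def IsMinimalStructure (A : GenClass G) : Prop :=
  Minimal (· ∈ hyperbolicStructures G \ ellipticStructures G) A

end Structures

/-- The direct sum of copies of the infinite dihedral group `D_∞` (`DihedralGroup 0` in Mathlib)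
indexed by `I`: the finitely supported elements of the full product. -/
def dihedralSum (I : Type u) : Subgroup (I → DihedralGroup 0) where
  carrier := {f | (Function.mulSupport f).Finite}
  one_mem' := by simp
  mul_mem' := by
    intro f g hf hg
    exact (hf.union hg).subset (Function.mulSupport_mul f g)
  inv_mem' := by
    intro f hf
    simpa using hf

end HypStr

/-! Slim triangles give the four-point inequality, and afterwards only this inequality and left
invariance of the word metric are used. The engine is a ping-pong-free construction of an axis: if
d(1, t²) exceeds d(1, t) by more than 2δ, then the powers of t form a quasi-geodesic line
(`IsHypMetric.isAxial`). Such a t exists as soon as the boundary is nonempty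
(`GenSet.exists_strong`), and any element whose powers grow linearly has a power of this kind
(`exists_pow_displacement`).

(a) Let X be lineal, let Y ≤ X be hyperbolic and not elliptic, and take an axial s for Y. Its powers
also grow linearly for X, so a power of s is axial for X. Since the boundary of Γ(G, X) consists of
the two ends of this axis, G lies in a bounded neighbourhood of a cyclic group
(`near_axis_of_card`). The metrics are comparable along that group, so X ≤ Y (`le_of_lineal`).
Minimality makes the lineal structures an antichain.

(b) An orientable lineal structure has a Busemann function at a fixed end, which is a quasimorphism
measuring word length up to bounded error (`exists_quasimorphism_of_orientable`). Conversely every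
unbounded quasimorphism is a quasi-isometry to the line for some generating set
(`IsQuasimorphism.exists_orientable`). Two distinct structures give quasimorphisms φ, ψ independent
modulo bounded functions, and the combinations φ + sψ, for real s, give pairwise distinct
structures.

(c) Each coordinate of the dihedral sum acts on the line and gives a lineal structure. Given any
non-elliptic hyperbolic structure, some coordinate rotation ρ has linear growth, since otherwise all
products of the commuting rotations, among them all squares, would grow sublinearly. The remaining
coordinates commute with ρ, hence stay near its axis; they also commute with the reflection that
flips this axis, hence stay near its centre. So word length is bounded by that coordinate
(`exists_coord_bound`), and minimality from (a) identifies the structure. The reflection swaps the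
two ends, so nothing is orientable. -/

namespace HypStr

/-! ### Slim triangles and the four-point condition -/

section Geodesics

variable {V : Type u} {Γ : SimpleGraph V}

/-- The four-point condition, written for the combinatorial distance of a graph. -/
def FourPoint (Γ : SimpleGraph V) (δ : ℕ) : Prop :=
  ∀ x y z w : V, Γ.dist x y + Γ.dist z w ≤ Γ.dist x z + Γ.dist y w + δ ∨
    Γ.dist x y + Γ.dist z w ≤ Γ.dist x w + Γ.dist y z + δ

theorem exists_geodesic (hc : Γ.Connected) (x y : V) : ∃ p : Γ.Walk x y, IsGeodesicWalk Γ p :=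
  hc.exists_walk_length_eq_dist x y

theorem IsGeodesicWalk.reverse {x y : V} {p : Γ.Walk x y} (hp : IsGeodesicWalk Γ p) :
    IsGeodesicWalk Γ p.reverse := by
  unfold IsGeodesicWalk at *
  rw [SimpleGraph.Walk.length_reverse, hp, SimpleGraph.dist_comm]

/-- A vertex on a geodesic splits it into two geodesics. -/
theorem IsGeodesicWalk.split (hc : Γ.Connected) {x y a : V} {p : Γ.Walk x y}
    (hp : IsGeodesicWalk Γ p) (ha : a ∈ p.support) :
    ∃ (q : Γ.Walk x a) (r : Γ.Walk a y), p = q.append r ∧ IsGeodesicWalk Γ q ∧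
      IsGeodesicWalk Γ r ∧ Γ.dist x a + Γ.dist a y = Γ.dist x y := by
  obtain ⟨q, r, rfl⟩ := SimpleGraph.Walk.mem_support_iff_exists_append.1 ha
  have h1 := SimpleGraph.dist_le q
  have h2 := SimpleGraph.dist_le r
  have h3 : Γ.dist x y ≤ Γ.dist x a + Γ.dist a y := hc.dist_triangle
  have h4 : (q.append r).length = Γ.dist x y := hp
  rw [SimpleGraph.Walk.length_append] at h4
  unfold IsGeodesicWalk
  exact ⟨q, r, rfl, by omega, by omega, by omega⟩

theorem IsGeodesicWalk.dist_add (hc : Γ.Connected) {x y a : V} {p : Γ.Walk x y}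
    (hp : IsGeodesicWalk Γ p) (ha : a ∈ p.support) :
    Γ.dist x a + Γ.dist a y = Γ.dist x y := by
  obtain ⟨_, _, _, _, _, h⟩ := hp.split hc ha
  exact h

/-- A discrete connectedness argument, used to find a point on one side of a slim triangle that is
close to both other sides. -/
theorem exists_switch {P Q : V → Prop} {x y : V} (p : Γ.Walk x y)
    (h : ∀ a ∈ p.support, P a ∨ Q a) (hx : P x) (hy : Q y) :
    ∃ a ∈ p.support, P a ∧ ∃ b, Γ.dist a b ≤ 1 ∧ Q b := by
  induction p with
  | nil => exact ⟨_, by simp, hx, _, by simp, hy⟩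
  | @cons u v w e p ih =>
    by_cases hv : Q v
    · exact ⟨u, by simp, hx, v, (SimpleGraph.dist_eq_one_iff_adj.2 e).le, hv⟩
    · have hPv : P v := (h v (by simp)).resolve_right hv
      obtain ⟨a, ha, h'⟩ := ih (fun a ha => h a (by simp [ha])) hPv hy
      exact ⟨a, by simp [ha], h'⟩

/-- In a graph with `δ`-slim triangles the distance to a geodesic is at most the Gromov product of
its endpoints, up to a constant. -/
theorem exists_near_geodesic (hc : Γ.Connected) {δ : ℕ}
    (hδ : ∀ (x y z : V) (p : Γ.Walk x y) (q : Γ.Walk y z) (r : Γ.Walk z x),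
      IsGeodesicWalk Γ p → IsGeodesicWalk Γ q → IsGeodesicWalk Γ r →
      ∀ a ∈ p.support, ∃ b, (b ∈ q.support ∨ b ∈ r.support) ∧ Γ.dist a b ≤ δ)
    (s x y : V) (p : Γ.Walk x y) (hp : IsGeodesicWalk Γ p) :
    ∃ a ∈ p.support, 2 * Γ.dist s a + Γ.dist x y ≤ Γ.dist s x + Γ.dist s y + (4 * δ + 2) := by
  obtain ⟨q, hq⟩ := exists_geodesic hc y s
  obtain ⟨r, hr⟩ := exists_geodesic hc s x
  obtain ⟨a, ha, ⟨u, hu, hau⟩, b, hab, v, hv, hbv⟩ := exists_switch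
    (P := fun a => ∃ u ∈ r.support, Γ.dist a u ≤ δ)
    (Q := fun a => ∃ u ∈ q.support, Γ.dist a u ≤ δ) p
    (fun a ha => by
      obtain ⟨b, hb | hb, h⟩ := hδ x y s p q r hp hq hr a ha
      · exact Or.inr ⟨b, hb, h⟩
      · exact Or.inl ⟨b, hb, h⟩)
    ⟨x, by simp, by simp⟩ ⟨y, by simp, by simp⟩
  refine ⟨a, ha, ?_⟩
  have h1 := hp.dist_add hc ha
  have h2 := hr.dist_add hc hu
  have h3 := hq.dist_add hc hv
  have t1 : Γ.dist s a ≤ Γ.dist s u + Γ.dist u a := hc.dist_triangle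
  have t2 : Γ.dist x a ≤ Γ.dist x u + Γ.dist u a := hc.dist_triangle
  have t3 : Γ.dist a v ≤ Γ.dist a b + Γ.dist b v := hc.dist_triangle
  have t4 : Γ.dist s a ≤ Γ.dist s v + Γ.dist v a := hc.dist_triangle
  have t5 : Γ.dist a y ≤ Γ.dist a v + Γ.dist v y := hc.dist_triangle
  rw [SimpleGraph.dist_comm (u := u) (v := a)] at t1 t2
  rw [SimpleGraph.dist_comm (u := x) (v := u)] at t2
  rw [SimpleGraph.dist_comm (u := v) (v := a)] at t4
  rw [SimpleGraph.dist_comm (u := v) (v := y)] at t5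
  rw [SimpleGraph.dist_comm (u := v) (v := s), SimpleGraph.dist_comm (u := y) (v := s)] at h3
  omega

/-- Some point of the side [x, z] is at distance from s about the Gromov product (x | z). Slimness
moves it by δ onto another side, and every point of that side is at least as far from s as the
Gromov product of its endpoints. Hence (x | z) is at least the minimum of the other two products, up
to 3δ + 1; doubling gives the constant. -/
theorem IsHyperbolicGraph.fourPoint (h : IsHyperbolicGraph Γ) : ∃ δ, FourPoint Γ δ := by
  obtain ⟨hc, δ, hδ⟩ := h
  refine ⟨6 * δ + 2, fun x z y s => ?_⟩
  obtain ⟨p, hp⟩ := exists_geodesic hc x z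
  obtain ⟨q, hq⟩ := exists_geodesic hc z y
  obtain ⟨r, hr⟩ := exists_geodesic hc y x
  obtain ⟨a, ha, h1⟩ := exists_near_geodesic hc hδ s x z p hp
  obtain ⟨b, hb, hab⟩ := hδ x z y p q r hp hq hr a ha
  have t : Γ.dist s b ≤ Γ.dist s a + Γ.dist a b := hc.dist_triangle
  have c1 := SimpleGraph.dist_comm (G := Γ) (u := y) (v := s)
  have c2 := SimpleGraph.dist_comm (G := Γ) (u := z) (v := s)
  have c3 := SimpleGraph.dist_comm (G := Γ) (u := x) (v := s)
  have c4 := SimpleGraph.dist_comm (G := Γ) (u := x) (v := y)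
  rcases hb with hb | hb
  · have h2 := hq.dist_add hc hb
    have t1 : Γ.dist s z ≤ Γ.dist s b + Γ.dist b z := hc.dist_triangle
    have t2 : Γ.dist s y ≤ Γ.dist s b + Γ.dist b y := hc.dist_triangle
    have c5 := SimpleGraph.dist_comm (G := Γ) (u := z) (v := b)
    omega
  · have h2 := hr.dist_add hc hb
    have t1 : Γ.dist s y ≤ Γ.dist s b + Γ.dist b y := hc.dist_triangle
    have t2 : Γ.dist s x ≤ Γ.dist s b + Γ.dist b x := hc.dist_triangle
    have c5 := SimpleGraph.dist_comm (G := Γ) (u := y) (v := b)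
    omega

/-! ### Sequences converging at infinity -/

theorem fellow_iff {x y : ℕ → V} : Fellow Γ x y ↔ ∀ (s : V) (M : ℕ), ∃ N, ∀ i ≥ N, ∀ j ≥ N,
    M + Γ.dist (x i) (y j) ≤ Γ.dist (x i) s + Γ.dist (y j) s := by
  refine forall_congr' fun s => ?_
  rw [Filter.tendsto_atTop]
  constructor
  · intro h M
    obtain ⟨⟨a, b⟩, hab⟩ := Filter.eventually_atTop.1 (h M)
    refine ⟨max a b, fun i hi j hj => ?_⟩
    have := hab (i, j) ⟨(le_max_left a b).trans hi, (le_max_right a b).trans hj⟩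
    unfold gromovProduct at this
    have h0 : (M : ℝ) ≥ 0 := by positivity
    have : (M : ℝ) + Γ.dist (x i) (y j) ≤ Γ.dist (x i) s + Γ.dist (y j) s := by
      dsimp only at this; linarith
    exact_mod_cast this
  · intro h b
    obtain ⟨N, hN⟩ := h (2 * ⌈b⌉₊)
    refine Filter.eventually_atTop.2 ⟨(N, N), fun ij hij => ?_⟩
    have h1 := hN ij.1 hij.1 ij.2 hij.2
    have h2 : (2 * ⌈b⌉₊ : ℝ) + Γ.dist (x ij.1) (y ij.2) ≤
      Γ.dist (x ij.1) s + Γ.dist (y ij.2) s := by exact_mod_cast h1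
    have h3 := Nat.le_ceil b
    unfold gromovProduct
    linarith

theorem fellow_of_base (hc : Γ.Connected) {x y : ℕ → V} (s : V) (h : ∀ M : ℕ, ∃ N, ∀ i ≥ N, ∀ j ≥ N,
    M + Γ.dist (x i) (y j) ≤ Γ.dist (x i) s + Γ.dist (y j) s) : Fellow Γ x y := by
  refine fellow_iff.2 fun s' M => ?_
  obtain ⟨N, hN⟩ := h (M + 2 * Γ.dist s' s)
  refine ⟨N, fun i hi j hj => ?_⟩
  have := hN i hi j hj
  have t1 : Γ.dist (x i) s ≤ Γ.dist (x i) s' + Γ.dist s' s := hc.dist_triangle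
  have t2 : Γ.dist (y j) s ≤ Γ.dist (y j) s' + Γ.dist s' s := hc.dist_triangle
  omega

theorem Fellow.symm {x y : ℕ → V} (h : Fellow Γ x y) : Fellow Γ y x := by
  rw [fellow_iff] at *
  intro s M
  obtain ⟨N, hN⟩ := h s M
  refine ⟨N, fun i hi j hj => ?_⟩
  rw [SimpleGraph.dist_comm, add_comm (Γ.dist _ s)]
  exact hN j hj i hi

theorem FourPoint.fellow_trans {δ : ℕ} (hδ : FourPoint Γ δ) {x y z : ℕ → V} (h : Fellow Γ x y)
    (h' : Fellow Γ y z) : Fellow Γ x z := by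
  rw [fellow_iff] at *
  intro s M
  obtain ⟨N, hN⟩ := h s (M + δ)
  obtain ⟨N', hN'⟩ := h' s (M + δ)
  refine ⟨max N N', fun i hi k hk => ?_⟩
  have h1 := hN i ((le_max_left _ _).trans hi) _ (le_max_left N N')
  have h2 := hN' _ (le_max_right N N') k ((le_max_right _ _).trans hk)
  generalize y (max N N') = b at *
  have := hδ (x i) (z k) b s
  rw [SimpleGraph.dist_comm (u := z k) (v := b)] at this
  omega

/-- The boundary point represented by a sequence converging at infinity. -/
def boundaryPoint {x : ℕ → V} (h : Fellow Γ x x) : Boundary Γ :=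
  Quot.mk _ (⟨x, h⟩ : SeqAtInfinity Γ)

theorem boundaryPoint_eq {x y : ℕ → V} (hx : Fellow Γ x x) (hy : Fellow Γ y y)
    (h : Fellow Γ x y) : boundaryPoint hx = boundaryPoint hy :=
  Quot.sound h

theorem exists_boundaryPoint (ξ : Boundary Γ) :
    ∃ (x : ℕ → V) (h : Fellow Γ x x), ξ = boundaryPoint h := by
  obtain ⟨⟨x, hx⟩, rfl⟩ := Quot.exists_rep ξ
  exact ⟨x, hx, rfl⟩

/-- `Quot` identifies along the generated equivalence relation; the four-point condition makes
`Fellow` transitive, so nothing more is identified. -/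
theorem FourPoint.fellow_of_boundaryPoint_eq {δ : ℕ} (hδ : FourPoint Γ δ) {x y : ℕ → V}
    {hx : Fellow Γ x x} {hy : Fellow Γ y y} (h : boundaryPoint hx = boundaryPoint hy) :
    Fellow Γ x y := by
  have key : ∀ a b : SeqAtInfinity Γ,
      Relation.EqvGen (fun x y : SeqAtInfinity Γ => Fellow Γ x.1 y.1) a b → Fellow Γ a.1 b.1 := by
    intro a b hab
    induction hab with
    | rel _ _ h => exact h
    | refl a => exact a.2
    | symm _ _ _ ih => exact ih.symm
    | trans _ _ _ _ _ h h' => exact hδ.fellow_trans h h'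
  exact key (⟨x, hx⟩ : SeqAtInfinity Γ) (⟨y, hy⟩ : SeqAtInfinity Γ) (Quot.eqvGen_exact h)

/-! ### Quasi-lines -/

/-- `φ` is a quasi-isometric embedding of the vertices of `Γ` into the real line. -/
structure IsQuasiLine (Γ : SimpleGraph V) (φ : V → ℝ) (L : ℝ) : Prop where
  connected : Γ.Connected
  one_le : 1 ≤ L
  adj : ∀ x y, Γ.Adj x y → |φ x - φ y| ≤ L
  dist_le : ∀ x y, (Γ.dist x y : ℝ) ≤ L * |φ x - φ y| + L

namespace IsQuasiLine

variable {φ : V → ℝ} {L : ℝ}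

theorem neg (h : IsQuasiLine Γ φ L) : IsQuasiLine Γ (fun x => -φ x) L where
  connected := h.connected
  one_le := h.one_le
  adj x y e := by rw [← abs_neg]; convert h.adj x y e using 2; ring
  dist_le x y := by convert h.dist_le x y using 3; rw [← abs_neg]; congr 1; ring

theorem abs_sub_le_length (h : IsQuasiLine Γ φ L) {x y : V} (p : Γ.Walk x y) :
    |φ x - φ y| ≤ L * p.length := by
  induction p with
  | nil => simp
  | @cons u v w e p ih =>
    have := h.adj u v e
    have := abs_sub_le (φ u) (φ v) (φ w)
    push_cast [SimpleGraph.Walk.length_cons]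
    linarith

theorem abs_sub_le (h : IsQuasiLine Γ φ L) (x y : V) : |φ x - φ y| ≤ L * Γ.dist x y := by
  obtain ⟨p, hp⟩ := exists_geodesic h.connected x y
  have := h.abs_sub_le_length p
  rwa [hp] at this

theorem exists_cross_of_le (h : IsQuasiLine Γ φ L) {x y : V} (p : Γ.Walk x y) {v : ℝ}
    (h1 : φ x ≤ v) (h2 : v ≤ φ y) : ∃ a ∈ p.support, |φ a - v| ≤ L := by
  have hL := h.one_le
  induction p with
  | nil => exact ⟨_, SimpleGraph.Walk.start_mem_support _, by rw [le_antisymm h1 h2]; simp; linarith⟩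
  | @cons a b c e p ih =>
    by_cases hb : φ b ≤ v
    · obtain ⟨w, hw, hw'⟩ := ih hb h2
      exact ⟨w, by simp [hw], hw'⟩
    · have := h.adj a b e
      refine ⟨a, by simp, ?_⟩
      rw [abs_le] at *
      constructor <;> linarith

theorem exists_cross (h : IsQuasiLine Γ φ L) {x y : V} (p : Γ.Walk x y) {v : ℝ}
    (hv : v ∈ Set.uIcc (φ x) (φ y)) : ∃ a ∈ p.support, |φ a - v| ≤ L := by
  rcases Set.mem_uIcc.1 hv with ⟨h1, h2⟩ | ⟨h1, h2⟩
  · exact h.exists_cross_of_le p h1 h2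
  · obtain ⟨a, ha, h'⟩ := h.exists_cross_of_le p.reverse h1 h2
    exact ⟨a, by simpa using ha, h'⟩

/-- If the geodesic overshoots the level φ y at a, it crossed that level earlier, at some b. Then b
and y are close, because φ is a quasi-isometric embedding, and a lies between them on the geodesic.
-/
theorem geodesic_le_aux (h : IsQuasiLine Γ φ L) {x y : V} {p : Γ.Walk x y}
    (hp : IsGeodesicWalk Γ p) {a : V} (ha : a ∈ p.support) (hxy : φ x ≤ φ y) :
    φ a ≤ φ y + L * (L * L + L) := by
  have hL := h.one_le
  by_cases hay : φ a ≤ φ y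
  · nlinarith [mul_nonneg (by linarith : 0 ≤ L) (by nlinarith : 0 ≤ L * L + L)]
  obtain ⟨q, r, rfl, hq, hr, hd⟩ := hp.split h.connected ha
  obtain ⟨b, hb, hb'⟩ := h.exists_cross_of_le q hxy (not_le.1 hay).le
  have h1 := hq.dist_add h.connected hb
  have h2 : Γ.dist x y ≤ Γ.dist x b + Γ.dist b y := h.connected.dist_triangle
  have h3 : (Γ.dist a y : ℝ) ≤ Γ.dist b y := by
    have : Γ.dist a y ≤ Γ.dist b y := by omega
    exact_mod_cast this
  have h4 := h.dist_le b y
  have h5 : L * |φ b - φ y| ≤ L * L := mul_le_mul_of_nonneg_left hb' (by linarith)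
  have h6 := h.abs_sub_le a y
  have h7 : L * (Γ.dist a y : ℝ) ≤ L * (L * L + L) :=
    mul_le_mul_of_nonneg_left (by linarith) (by linarith)
  have := le_abs_self (φ a - φ y)
  linarith

theorem geodesic_le (h : IsQuasiLine Γ φ L) {x y : V} {p : Γ.Walk x y}
    (hp : IsGeodesicWalk Γ p) {a : V} (ha : a ∈ p.support) :
    φ a ≤ max (φ x) (φ y) + L * (L * L + L) := by
  rcases le_total (φ x) (φ y) with hxy | hxy
  · rw [max_eq_right hxy]
    exact h.geodesic_le_aux hp ha hxy
  · rw [max_eq_left hxy]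
    exact h.geodesic_le_aux hp.reverse (by simpa using ha) hxy

theorem le_geodesic (h : IsQuasiLine Γ φ L) {x y : V} {p : Γ.Walk x y}
    (hp : IsGeodesicWalk Γ p) {a : V} (ha : a ∈ p.support) :
    min (φ x) (φ y) - L * (L * L + L) ≤ φ a := by
  have := h.neg.geodesic_le hp ha
  rw [max_neg_neg] at this
  linarith

/-- Geodesics nearly project onto intervals of the line, and in the line each side of a triangle is
covered by the other two. -/
theorem isHyperbolicGraph (h : IsQuasiLine Γ φ L) : IsHyperbolicGraph Γ := by
  have hL := h.one_le
  refine ⟨h.connected, ⌈L * (L * (L * L + L) + L) + L⌉₊, fun x y z p q r hp _ _ a ha => ?_⟩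
  obtain ⟨v, hv, hav⟩ : ∃ v ∈ Set.uIcc (φ x) (φ y), |φ a - v| ≤ L * (L * L + L) := by
    have h1 := h.geodesic_le hp ha
    have h2 := h.le_geodesic hp ha
    have hM : 0 ≤ L * (L * L + L) := by positivity
    -- The witness is φ a truncated to the interval between φ x and φ y.
    refine ⟨max (min (φ x) (φ y)) (min (φ a) (max (φ x) (φ y))), ⟨le_max_left _ _, ?_⟩, ?_⟩
    · exact max_le min_le_max (min_le_right _ _)
    · rw [abs_le]
      have : min (φ x) (φ y) ≤ max (φ x) (φ y) := min_le_max
      generalize min (φ x) (φ y) = m at *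
      generalize max (φ x) (φ y) = m' at *
      rcases le_total (φ a) m' with h3 | h3
      · rw [min_eq_left h3]
        rcases le_total m (φ a) with h4 | h4
        · rw [max_eq_right h4]; constructor <;> linarith
        · rw [max_eq_left h4]; constructor <;> linarith
      · rw [min_eq_right h3, max_eq_right this]; constructor <;> linarith
  have key : ∃ b, (b ∈ q.support ∨ b ∈ r.support) ∧ |φ b - v| ≤ L := by
    rcases Set.uIcc_subset_uIcc_union_uIcc (b := φ z) hv with hv | hv
    · rw [Set.uIcc_comm] at hv
      obtain ⟨b, hb, hb'⟩ := h.exists_cross r hv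
      exact ⟨b, Or.inr hb, hb'⟩
    · rw [Set.uIcc_comm] at hv
      obtain ⟨b, hb, hb'⟩ := h.exists_cross q hv
      exact ⟨b, Or.inl hb, hb'⟩
  obtain ⟨b, hb, hb'⟩ := key
  refine ⟨b, hb, ?_⟩
  have h1 : |φ a - φ b| ≤ L * (L * L + L) + L := by
    have := _root_.abs_sub_le (φ a) v (φ b)
    rw [abs_sub_comm v] at this
    linarith
  have h2 := h.dist_le a b
  have h3 := mul_le_mul_of_nonneg_left h1 (by linarith : 0 ≤ L)
  have : (Γ.dist a b : ℝ) ≤ (⌈L * (L * (L * L + L) + L) + L⌉₊ : ℕ) :=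
    le_trans (by linarith) (Nat.le_ceil _)
  exact_mod_cast this

/-- A geodesic between two points far to the right of s stays far to the right, hence far from s,
and the Gromov product is at least its distance from s up to a constant. -/
theorem fellow_of_tendsto (h : IsQuasiLine Γ φ L) {x y : ℕ → V}
    (hx : Filter.Tendsto (fun n => φ (x n)) Filter.atTop Filter.atTop)
    (hy : Filter.Tendsto (fun n => φ (y n)) Filter.atTop Filter.atTop) : Fellow Γ x y := by
  have hL := h.one_le
  obtain ⟨hc, δ, hδ⟩ := h.isHyperbolicGraph
  refine fellow_iff.2 fun s M => ?_
  obtain ⟨N, hN⟩ := Filter.eventually_atTop.1 ((Filter.tendsto_atTop.1 hx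
    (φ s + L * (L * L + L) + L * (M + (4 * δ + 2)))).and (Filter.tendsto_atTop.1 hy
    (φ s + L * (L * L + L) + L * (M + (4 * δ + 2)))))
  refine ⟨N, fun i hi j hj => ?_⟩
  obtain ⟨p, hp⟩ := exists_geodesic hc (x i) (y j)
  obtain ⟨a, ha, h1⟩ := exists_near_geodesic hc hδ s (x i) (y j) p hp
  have h2 := h.le_geodesic hp ha
  have h3 := le_min (hN i hi).1 (hN j hj).2
  have h4 := h.abs_sub_le s a
  have h5 := neg_abs_le (φ s - φ a)
  have h6 : L * (M + (4 * δ + 2)) ≤ L * Γ.dist s a := by linarith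
  have h7 : (M + (4 * δ + 2) : ℝ) ≤ Γ.dist s a := le_of_mul_le_mul_left h6 (by linarith)
  have h8 : M + (4 * δ + 2) ≤ Γ.dist s a := by exact_mod_cast h7
  rw [SimpleGraph.dist_comm (v := s), SimpleGraph.dist_comm (v := s)]
  omega

theorem fellow_of_tendsto_atBot (h : IsQuasiLine Γ φ L) {x y : ℕ → V}
    (hx : Filter.Tendsto (fun n => φ (x n)) Filter.atTop Filter.atBot)
    (hy : Filter.Tendsto (fun n => φ (y n)) Filter.atTop Filter.atBot) : Fellow Γ x y :=
  h.neg.fellow_of_tendsto (Filter.tendsto_neg_atBot_atTop.comp hx)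
    (Filter.tendsto_neg_atBot_atTop.comp hy)

/-- A geodesic from x to y crosses the level φ s, hence passes close to s. So points on opposite
sides of s have bounded Gromov product, and fellow sequences must end up on one side. -/
theorem gromov_le (h : IsQuasiLine Γ φ L) {s x y : V} (hx : φ x ≤ φ s) (hy : φ s ≤ φ y) :
    (Γ.dist x s + Γ.dist y s : ℝ) ≤ Γ.dist x y + 2 * (L * L + L) := by
  have hL := h.one_le
  obtain ⟨p, hp⟩ := exists_geodesic h.connected x y
  obtain ⟨b, hb, hb'⟩ := h.exists_cross_of_le p hx hy
  have h1 := hp.dist_add h.connected hb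
  have h2 : Γ.dist x s ≤ Γ.dist x b + Γ.dist b s := h.connected.dist_triangle
  have h3 : Γ.dist y s ≤ Γ.dist y b + Γ.dist b s := h.connected.dist_triangle
  rw [SimpleGraph.dist_comm (u := y) (v := b)] at h3
  have h4 := h.dist_le b s
  have h5 : L * |φ b - φ s| ≤ L * L := mul_le_mul_of_nonneg_left hb' (by linarith)
  have h6 : (Γ.dist x s + Γ.dist y s : ℝ) ≤ Γ.dist x y + 2 * Γ.dist b s := by
    have : Γ.dist x s + Γ.dist y s ≤ Γ.dist x y + 2 * Γ.dist b s := by omega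
    exact_mod_cast this
  linarith

theorem same_side (h : IsQuasiLine Γ φ L) {x y : ℕ → V} (hf : Fellow Γ x y) (s : V) :
    ∃ N, (∀ i ≥ N, ∀ j ≥ N, φ s < φ (x i) ∧ φ s < φ (y j)) ∨
      (∀ i ≥ N, ∀ j ≥ N, φ (x i) < φ s ∧ φ (y j) < φ s) := by
  obtain ⟨N, hN⟩ := fellow_iff.1 hf s (⌈2 * (L * L + L)⌉₊ + 1)
  have key : ∀ i ≥ N, ∀ j ≥ N, (φ s < φ (x i) ∧ φ s < φ (y j)) ∨
      (φ (x i) < φ s ∧ φ (y j) < φ s) := by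
    intro i hi j hj
    have h1 : ((⌈2 * (L * L + L)⌉₊ : ℝ) + 1) + Γ.dist (x i) (y j) ≤
        Γ.dist (x i) s + Γ.dist (y j) s := by exact_mod_cast hN i hi j hj
    have h2 := Nat.le_ceil (2 * (L * L + L))
    rcases le_or_gt (φ (x i)) (φ s) with ha | ha <;> rcases le_or_gt (φ (y j)) (φ s) with hb | hb
    · rcases ha.lt_or_eq with ha' | ha'
      · rcases hb.lt_or_eq with hb' | hb'
        · exact Or.inr ⟨ha', hb'⟩
        · have := h.gromov_le ha hb'.ge
          linarith
      · have := h.gromov_le hb ha'.ge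
        rw [SimpleGraph.dist_comm (u := y j) (v := x i)] at this
        linarith
    · have := h.gromov_le ha hb.le
      linarith
    · have := h.gromov_le hb ha.le
      rw [SimpleGraph.dist_comm (u := y j) (v := x i)] at this
      linarith
    · exact Or.inl ⟨ha, hb⟩
  refine ⟨N, ?_⟩
  rcases key N le_rfl N le_rfl with h0 | h0
  · left
    intro i hi j hj
    have h1 := key i hi N le_rfl
    have h2 := key N le_rfl j hj
    constructor
    · rcases h1 with h1 | h1
      · exact h1.1
      · linarith [h0.2, h1.2]
    · rcases h2 with h2 | h2
      · exact h2.2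
      · linarith [h0.1, h2.1]
  · right
    intro i hi j hj
    have h1 := key i hi N le_rfl
    have h2 := key N le_rfl j hj
    constructor
    · rcases h1 with h1 | h1
      · linarith [h0.2, h1.2]
      · exact h1.1
    · rcases h2 with h2 | h2
      · linarith [h0.1, h2.1]
      · exact h2.2

theorem not_between (h : IsQuasiLine Γ φ L) {x y : ℕ → V} (hf : Fellow Γ x y) (s s' : V) (N : ℕ)
    (hN : ∀ i ≥ N, ∀ j ≥ N, (φ s < φ (x i) ∧ φ s < φ (y j)) ∧
      (φ (x i) < φ s' ∧ φ (y j) < φ s')) : False := by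
  have hL := h.one_le
  obtain ⟨N', hN'⟩ := fellow_iff.1 hf s (2 * ⌈L * |φ s' - φ s| + L⌉₊ + 1)
  have bound : ∀ v, φ s < φ v → φ v < φ s' → Γ.dist v s ≤ ⌈L * |φ s' - φ s| + L⌉₊ := by
    intro v h1 h2
    have h3 := h.dist_le v s
    rw [abs_of_pos (by linarith)] at h3
    have h4 : L * (φ v - φ s) ≤ L * |φ s' - φ s| :=
      mul_le_mul_of_nonneg_left ((by linarith : φ v - φ s ≤ φ s' - φ s).trans (le_abs_self _))
        (by linarith)
    have : (Γ.dist v s : ℝ) ≤ (⌈L * |φ s' - φ s| + L⌉₊ : ℕ) :=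
      le_trans (by linarith) (Nat.le_ceil _)
    exact_mod_cast this
  have hm := hN _ (le_max_left N N') _ (le_max_left N N')
  have hm' := hN' _ (le_max_right N N') _ (le_max_right N N')
  have := bound _ hm.1.1 hm.2.1
  have := bound _ hm.1.2 hm.2.2
  omega

/-- Eventually the sequences lie on one side of each s; they cannot stay between two levels, since
that strip is bounded while their Gromov products are not. -/
theorem tendsto_of_fellow (h : IsQuasiLine Γ φ L)
    (hu : ∀ R, ∃ s, R ≤ φ s) (hd : ∀ R, ∃ s, φ s ≤ R) {x y : ℕ → V} (hf : Fellow Γ x y) :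
    (Filter.Tendsto (fun n => φ (x n)) Filter.atTop Filter.atTop ∧
      Filter.Tendsto (fun n => φ (y n)) Filter.atTop Filter.atTop) ∨
    (Filter.Tendsto (fun n => φ (x n)) Filter.atTop Filter.atBot ∧
      Filter.Tendsto (fun n => φ (y n)) Filter.atTop Filter.atBot) := by
  obtain ⟨s₀, -⟩ := hu 0
  obtain ⟨N₀, h0⟩ := h.same_side hf s₀
  rcases h0 with h0 | h0
  · left
    have key : ∀ R, ∃ N, ∀ i ≥ N, R ≤ φ (x i) ∧ R ≤ φ (y i) := by
      intro R
      obtain ⟨s, hs⟩ := hu R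
      obtain ⟨N, h1 | h1⟩ := h.same_side hf s
      · exact ⟨N, fun i hi => ⟨hs.trans (h1 i hi i hi).1.le, hs.trans (h1 i hi i hi).2.le⟩⟩
      · refine (h.not_between hf s₀ s (max N N₀) fun i hi j hj => ⟨?_, ?_⟩).elim
        · exact h0 i ((le_max_right _ _).trans hi) j ((le_max_right _ _).trans hj)
        · exact h1 i ((le_max_left _ _).trans hi) j ((le_max_left _ _).trans hj)
    constructor <;> refine Filter.tendsto_atTop.2 fun R => ?_ <;> obtain ⟨N, hN⟩ := key R
    · exact Filter.eventually_atTop.2 ⟨N, fun i hi => (hN i hi).1⟩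
    · exact Filter.eventually_atTop.2 ⟨N, fun i hi => (hN i hi).2⟩
  · right
    have key : ∀ R, ∃ N, ∀ i ≥ N, φ (x i) ≤ R ∧ φ (y i) ≤ R := by
      intro R
      obtain ⟨s, hs⟩ := hd R
      obtain ⟨N, h1 | h1⟩ := h.same_side hf s
      · refine (h.not_between hf s s₀ (max N N₀) fun i hi j hj => ⟨?_, ?_⟩).elim
        · exact h1 i ((le_max_left _ _).trans hi) j ((le_max_left _ _).trans hj)
        · exact h0 i ((le_max_right _ _).trans hi) j ((le_max_right _ _).trans hj)
      · exact ⟨N, fun i hi => ⟨(h1 i hi i hi).1.le.trans hs, (h1 i hi i hi).2.le.trans hs⟩⟩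
    constructor <;> refine Filter.tendsto_atBot.2 fun R => ?_ <;> obtain ⟨N, hN⟩ := key R
    · exact Filter.eventually_atTop.2 ⟨N, fun i hi => (hN i hi).1⟩
    · exact Filter.eventually_atTop.2 ⟨N, fun i hi => (hN i hi).2⟩

theorem exists_tendsto_atTop (hu : ∀ R, ∃ s, R ≤ φ s) :
    ∃ x : ℕ → V, Filter.Tendsto (fun n => φ (x n)) Filter.atTop Filter.atTop := by
  choose f hf using hu
  exact ⟨fun n => f n, Filter.tendsto_atTop_mono (fun n => hf n) tendsto_natCast_atTop_atTop⟩

theorem not_fellow (h : IsQuasiLine Γ φ L)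
    (hu : ∀ R, ∃ s, R ≤ φ s) (hd : ∀ R, ∃ s, φ s ≤ R) {x y : ℕ → V}
    (hx : Filter.Tendsto (fun n => φ (x n)) Filter.atTop Filter.atTop)
    (hy : Filter.Tendsto (fun n => φ (y n)) Filter.atTop Filter.atBot) : ¬ Fellow Γ x y := by
  intro hf
  rcases h.tendsto_of_fellow hu hd hf with h' | h'
  · exact hy.not_tendsto Filter.disjoint_atBot_atTop h'.2
  · exact hx.not_tendsto Filter.disjoint_atTop_atBot h'.1

theorem card_boundary (h : IsQuasiLine Γ φ L)
    (hu : ∀ R, ∃ s, R ≤ φ s) (hd : ∀ R, ∃ s, φ s ≤ R) : Nat.card (Boundary Γ) = 2 := by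
  obtain ⟨δ, hδ⟩ := h.isHyperbolicGraph.fourPoint
  obtain ⟨x, hx⟩ := exists_tendsto_atTop hu
  obtain ⟨y, hy⟩ : ∃ y : ℕ → V, Filter.Tendsto (fun n => φ (y n)) Filter.atTop Filter.atBot := by
    obtain ⟨y, hy⟩ := exists_tendsto_atTop (φ := fun s => -φ s)
      (fun R => (hd (-R)).imp fun s hs => by linarith)
    exact ⟨y, (Filter.tendsto_neg_atTop_atBot.comp hy).congr fun n => neg_neg _⟩
  have hxx := h.fellow_of_tendsto hx hx
  have hyy := h.fellow_of_tendsto_atBot hy hy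
  refine Nat.card_eq_two_iff.2 ⟨boundaryPoint hxx, boundaryPoint hyy, ?_, ?_⟩
  · intro he
    exact h.not_fellow hu hd hx hy (hδ.fellow_of_boundaryPoint_eq he)
  · refine Set.eq_univ_of_forall fun ξ => ?_
    obtain ⟨z, hz, rfl⟩ := exists_boundaryPoint ξ
    rcases h.tendsto_of_fellow hu hd hz with h' | h'
    · exact Or.inl (boundaryPoint_eq hz hxx (h.fellow_of_tendsto h'.1 hx))
    · exact Or.inr (boundaryPoint_eq hz hyy (h.fellow_of_tendsto_atBot h'.1 hy))

end IsQuasiLine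

end Geodesics

/-! ### Left-invariant hyperbolic metrics and axes -/

section Metric

variable {G : Type u} [Group G]

/-- A left-invariant pseudometric with natural values. -/
structure IsInvMetric (d : G → G → ℕ) : Prop where
  self : ∀ x, d x x = 0
  comm : ∀ x y, d x y = d y x
  tri : ∀ x y z, d x z ≤ d x y + d y z
  mul_left : ∀ g x y, d (g * x) (g * y) = d x y

/-- A left-invariant pseudometric with natural values that satisfies the four-point condition. -/
structure IsHypMetric (d : G → G → ℕ) (δ : ℕ) : Prop extends IsInvMetric d where
  four : ∀ x y z w, d x y + d z w ≤ d x z + d y w + δ ∨ d x y + d z w ≤ d x w + d y z + δ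

/-- The powers of `t` form a quasi-geodesic line for `d`. -/
structure IsAxial (d : G → G → ℕ) (t : G) (K : ℕ) : Prop where
  le : ∀ n : ℕ, n ≤ d 1 (t ^ n)
  add : ∀ m n : ℕ, d 1 (t ^ m) + d 1 (t ^ n) ≤ d 1 (t ^ (m + n)) + K

/-- An element whose powers grow linearly has a power with large displacement growth. -/
theorem exists_pow_displacement {d : G → G → ℕ} (δ : ℕ) {g : G} {c : ℕ} (hg : ∀ n : ℕ, n ≤ c * d 1 (g ^ n)) :
    ∃ m, 1 ≤ m ∧ d 1 (g ^ m) + 2 * δ + 1 ≤ d 1 (g ^ m * g ^ m) := by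
  -- Otherwise each doubling of the exponent adds at most 2δ to the length, so d(1, g^(2^j)) is at
  -- most linear in j. With the chosen i and j = 2i this gives (i + 1)² ≤ 2^(2i) ≤ i + i², which is
  -- false.
  by_contra! hcon
  have key : ∀ j : ℕ, d 1 (g ^ 2 ^ j) ≤ d 1 g + 2 * δ * j := by
    intro j
    induction j with
    | zero => simp
    | succ j ih =>
      have := hcon (2 ^ j) Nat.one_le_two_pow
      rw [← pow_add, ← two_mul, ← pow_succ'] at this
      rw [mul_add]
      omega
  set i := c * (d 1 g + 4 * δ) with hi
  have h1 := hg (2 ^ (2 * i))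
  have h2 := Nat.mul_le_mul_left c (key (2 * i))
  have h3 : i + 1 ≤ 2 ^ i := Nat.lt_two_pow_self
  have h4 : (i + 1) * (i + 1) ≤ 2 ^ (2 * i) := by
    rw [two_mul, pow_add]; exact Nat.mul_le_mul h3 h3
  have h5 : c * d 1 g ≤ i := by rw [hi]; nlinarith
  have h6 : c * (2 * δ * (2 * i)) ≤ i * i := by
    have : c * (4 * δ) ≤ i := by rw [hi]; nlinarith
    calc c * (2 * δ * (2 * i)) = c * (4 * δ) * i := by ring
      _ ≤ i * i := Nat.mul_le_mul_right _ this
  rw [mul_add] at h2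
  nlinarith

namespace IsInvMetric

variable {d : G → G → ℕ} (h : IsInvMetric d)
include h

theorem eq_one (x y : G) : d x y = d 1 (x⁻¹ * y) := by
  rw [← h.mul_left x 1, mul_one, mul_inv_cancel_left]

theorem inv (x : G) : d 1 x⁻¹ = d 1 x := by
  rw [← h.mul_left x, mul_one, mul_inv_cancel, h.comm]

theorem mul_le (x y : G) : d 1 (x * y) ≤ d 1 x + d 1 y := by
  have := h.tri 1 x (x * y)
  rw [h.eq_one x (x * y), inv_mul_cancel_left] at this
  exact this

theorem pow_le (x : G) (n : ℕ) : d 1 (x ^ n) ≤ n * d 1 x := by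
  induction n with
  | zero => simp [h.self]
  | succ n ih =>
    have := h.mul_le (x ^ n) x
    rw [pow_succ, add_mul]
    omega

theorem zpow_natAbs (x : G) (k : ℤ) : d 1 (x ^ k) = d 1 (x ^ k.natAbs) := by
  rcases Int.natAbs_eq k with hk | hk
  · conv_lhs => rw [hk, zpow_natCast]
  · conv_lhs => rw [hk, zpow_neg, zpow_natCast, h.inv]

theorem zpow_le (x : G) (k : ℤ) : d 1 (x ^ k) ≤ k.natAbs * d 1 x := by
  rw [h.zpow_natAbs]
  exact h.pow_le x _

theorem pow_pow {t : G} {m n : ℕ} (hmn : m ≤ n) : d (t ^ m) (t ^ n) = d 1 (t ^ (n - m)) := by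
  obtain ⟨k, rfl⟩ := Nat.exists_eq_add_of_le hmn
  rw [h.eq_one, pow_add, inv_mul_cancel_left, Nat.add_sub_cancel_left]

theorem zpow_zpow (t : G) (k l : ℤ) : d (t ^ k) (t ^ l) = d 1 (t ^ (l - k).natAbs) := by
  rw [h.eq_one, ← zpow_neg, ← zpow_add, h.zpow_natAbs]
  congr 3
  ring

end IsInvMetric

namespace IsHypMetric

variable {d : G → G → ℕ} {δ : ℕ} (h : IsHypMetric d δ)
include h

/-- Local-to-global: in the four-point condition for 1, t^n, t^(n+1), t^(n+2), the induction
hypothesis and the large d(1, t²) exclude one alternative; the other forces the length to grow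
again. -/
theorem strong_step {t : G} (ht : d 1 t + 2 * δ + 1 ≤ d 1 (t * t)) (n : ℕ) :
    d 1 (t ^ n) + (δ + 1) ≤ d 1 (t ^ (n + 1)) := by
  induction n with
  | zero =>
    have := h.mul_le t t
    have := h.self 1
    simp only [pow_zero, zero_add, pow_one]
    omega
  | succ n ih =>
    have h1 := h.four 1 (t ^ (n + 1)) (t ^ n) (t ^ (n + 1 + 1))
    have e1 : d (t ^ n) (t ^ (n + 1 + 1)) = d 1 (t * t) := by
      rw [h.pow_pow (by omega), ← pow_two]; congr 2; omega
    have e2 : d (t ^ (n + 1)) (t ^ (n + 1 + 1)) = d 1 t := by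
      rw [h.pow_pow (by omega)]; simp
    have e3 : d (t ^ (n + 1)) (t ^ n) = d 1 t := by
      rw [h.comm, h.pow_pow (by omega)]; simp
    omega

theorem isAxial {t : G} (ht : d 1 t + 2 * δ + 1 ≤ d 1 (t * t)) : IsAxial d t (d 1 t + δ) where
  le n := by
    induction n with
    | zero => simp
    | succ n ih => have := h.strong_step ht n; omega
  add m n := by
    cases n with
    | zero => simp [h.self]
    | succ n =>
      have h1 := h.four 1 (t ^ (m + 1)) (t ^ m) (t ^ (m + (n + 1)))
      have e1 : d (t ^ m) (t ^ (m + (n + 1))) = d 1 (t ^ (n + 1)) := by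
        rw [h.pow_pow (by omega)]; congr 2; omega
      have e2 : d (t ^ (m + 1)) (t ^ (m + (n + 1))) = d 1 (t ^ n) := by
        rw [h.pow_pow (by omega)]; congr 2; omega
      have e3 : d (t ^ (m + 1)) (t ^ m) = d 1 t := by
        rw [h.comm, h.pow_pow (by omega)]; simp
      have := h.strong_step ht n
      have := h.strong_step ht m
      omega

/-- If `a`, `b` are long and `ab` is as long as possible, then one of `a`, `b`, `ab` has large
displacement growth. -/
theorem exists_strong_of_geodesic {a b : G} {n : ℕ} (ha : d 1 a = n) (hb : d 1 b = n)
    (hab : d 1 (a * b) = 2 * n) (hn : 4 * δ + 1 ≤ n) :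
    ∃ t, d 1 t + 2 * δ + 1 ≤ d 1 (t * t) := by
  -- If g is long and d(1, g²) ≤ d(1, g) + 2δ, then g and g⁻¹ point in the same direction from 1.
  -- Now a⁻¹ and b are opposite, as d(a⁻¹, b) = 2n. So a is opposite to b (`g1`), then to b⁻¹
  -- (`g2`), then to (ab)⁻¹, which starts along b⁻¹ (`g3`). But ab starts along a and points the
  -- same way as (ab)⁻¹, a contradiction.
  by_contra! hcon
  have h1 := hcon a
  have h2 := hcon b
  have h3 := hcon (a * b)
  have e1 : d a⁻¹ b = 2 * n := by rw [h.eq_one, inv_inv, hab]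
  have e2 : d a a⁻¹ = d 1 (a * a) := by rw [h.comm, h.eq_one, inv_inv]
  have e3 : d b b⁻¹ = d 1 (b * b) := by rw [h.comm, h.eq_one, inv_inv]
  have e4 : d a (a * b) = n := by rw [h.eq_one, inv_mul_cancel_left, hb]
  have e5 : d (a * b)⁻¹ b⁻¹ = n := by rw [h.eq_one, inv_inv, mul_inv_cancel_right, ha]
  have e6 : d (a * b) (a * b)⁻¹ = d 1 ((a * b) * (a * b)) := by
    rw [h.comm, h.eq_one, inv_inv]
  have i1 := h.inv a
  have i2 := h.inv b
  have i3 := h.inv (a * b)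
  have c1 := h.comm 1 a
  have c2 := h.comm 1 b
  have c3 := h.comm 1 (a * b)
  have c4 := h.comm 1 a⁻¹
  have c5 := h.comm 1 b⁻¹
  have c6 := h.comm 1 (a * b)⁻¹
  have g1 : 2 * n ≤ d a b + δ := by
    have := h.comm a⁻¹ a
    have := h.comm b a
    rcases h.four a⁻¹ b a 1 with f | f <;> omega
  have g2 : 2 * n ≤ d a b⁻¹ + 2 * δ := by
    rcases h.four a b b⁻¹ 1 with f | f <;> omega
  have g3 : 3 * n ≤ d a (a * b)⁻¹ + 3 * δ := by
    have := h.comm b⁻¹ (a * b)⁻¹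
    rcases h.four a b⁻¹ (a * b)⁻¹ 1 with f | f <;> omega
  have := h.comm (a * b)⁻¹ (a * b)
  rcases h.four a (a * b)⁻¹ (a * b) 1 with f | f <;> omega

variable {t : G} {K : ℕ}

/-- A point between the ends of a long segment of the axis of `t` is close to the axis. -/
theorem near_axis (ax : IsAxial d t K) {g : G} {N K' : ℕ}
    (hg : d g (t ^ N)⁻¹ + d g (t ^ N) ≤ d (t ^ N)⁻¹ (t ^ N) + K') :
    ∃ k : ℤ, d g (t ^ k) ≤ d 1 t + K + K' + δ := by
  set A := d g (t ^ N)⁻¹ with hA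
  have eN : d (t ^ N)⁻¹ (t ^ N) = d 1 (t ^ (2 * N)) := by
    rw [h.eq_one, inv_inv, ← pow_add, two_mul]
  -- A discrete intermediate value: the last j for which t^(j-N) is not farther than g from the end
  -- t^(-N). Two points between the same ends and at nearly equal distance from one end are close,
  -- by the four-point condition.
  obtain ⟨j, hj, hj1, hj2⟩ : ∃ j ≤ 2 * N, d 1 (t ^ j) ≤ A ∧ A ≤ d 1 (t ^ j) + d 1 t + K' := by
    have h0 : d 1 (t ^ 0) ≤ A := by simp [h.self]
    have h1 := Nat.findGreatest_le (P := fun j => d 1 (t ^ j) ≤ A) (2 * N)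
    have h2 := Nat.findGreatest_spec (P := fun j => d 1 (t ^ j) ≤ A) (Nat.zero_le (2 * N)) h0
    have h3 := fun j => Nat.findGreatest_is_greatest (P := fun j => d 1 (t ^ j) ≤ A) (n := 2 * N)
      (k := j)
    generalize Nat.findGreatest (fun j => d 1 (t ^ j) ≤ A) (2 * N) = j at *
    refine ⟨j, h1, h2, ?_⟩
    rcases h1.lt_or_eq with hlt | rfl
    · have h4 := h3 (j + 1) (Nat.lt_succ_self _) hlt
      have h5 := h.mul_le (t ^ j) t
      rw [← pow_succ] at h5
      omega
    · omega
  refine ⟨(j : ℤ) - N, ?_⟩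
  have e0 : t ^ ((j : ℤ) - N) = (t ^ N)⁻¹ * t ^ j := by
    rw [sub_eq_neg_add, zpow_add, zpow_neg, zpow_natCast, zpow_natCast]
  rw [e0]
  have e1 : d ((t ^ N)⁻¹ * t ^ j) (t ^ N)⁻¹ = d 1 (t ^ j) := by
    rw [h.comm, h.eq_one, inv_inv, mul_inv_cancel_left]
  have e2 : d ((t ^ N)⁻¹ * t ^ j) (t ^ N) = d 1 (t ^ (2 * N - j)) := by
    rw [h.eq_one, mul_inv_rev, inv_inv, mul_assoc, ← pow_add, ← two_mul,
      ← h.pow_pow hj, ← h.eq_one]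
  have h1 := ax.add j (2 * N - j)
  rw [Nat.add_sub_cancel' hj] at h1
  have h2 := h.four g ((t ^ N)⁻¹ * t ^ j) (t ^ N)⁻¹ (t ^ N)
  omega

theorem axis_between (ax : IsAxial d t K) (g : G) (N : ℕ) :
    d g (g * (t ^ N)⁻¹) + d g (g * t ^ N) ≤ d (g * (t ^ N)⁻¹) (g * t ^ N) + K := by
  have h1 := ax.add N N
  rw [h.mul_left, h.eq_one g, inv_mul_cancel_left, h.eq_one g, inv_mul_cancel_left, h.inv,
    h.eq_one (t ^ N)⁻¹, inv_inv, ← pow_add]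
  exact h1

/-- If the ends of the translate by `g` of a segment of the axis of `t` are close, as seen from
`g`, to the ends of that segment, then `g` is close to the axis. -/
theorem near_axis_of_ends (ax : IsAxial d t K) {g y y' : G} {N : ℕ}
    (hy : (y = t ^ N ∧ y' = (t ^ N)⁻¹) ∨ (y = (t ^ N)⁻¹ ∧ y' = t ^ N))
    (h1 : K + δ + d (g * (t ^ N)⁻¹) y < d (g * (t ^ N)⁻¹) g + d y g)
    (h2 : K + 2 * δ + d (g * t ^ N) y' < d (g * t ^ N) g + d y' g) :
    ∃ k : ℤ, d g (t ^ k) ≤ d 1 t + K + (K + 2 * δ) + δ := by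
  -- As seen from g, the points g t^(±N) are opposite; y follows g t^(-N), so it is opposite to g
  -- t^N, and y' follows g t^N. Hence y and y' are opposite, so g lies between them.
  have h3 := h.axis_between ax g N
  have h4 := h.four (g * (t ^ N)⁻¹) (g * t ^ N) y g
  have h5 := h.four (g * t ^ N) y y' g
  have c1 := h.comm (g * (t ^ N)⁻¹) g
  have c2 := h.comm (g * t ^ N) g
  have c3 := h.comm (g * t ^ N) y
  have c4 := h.comm y g
  have c5 := h.comm y' g
  have c6 := h.comm y y'
  refine h.near_axis ax (N := N) ?_
  rcases hy with ⟨rfl, rfl⟩ | ⟨rfl, rfl⟩ <;> omega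

/-- Right translation by a commuting g moves every power of t by exactly d(1, g), so for N large
compared with d(1, g) the translated segment has the same ends as seen from g. -/
theorem near_axis_of_commute (ax : IsAxial d t K) {g : G} (hg : Commute g t) :
    ∃ k : ℤ, d g (t ^ k) ≤ d 1 t + K + (K + 2 * δ) + δ := by
  set N := d 1 g + K + 2 * δ + 1 with hN
  have h1 := ax.le N
  have e1 : d (g * t ^ N) (t ^ N) = d 1 g := by
    rw [h.comm, (hg.pow_right N).eq, h.eq_one, inv_mul_cancel_left]
  have e2 : d (g * (t ^ N)⁻¹) (t ^ N)⁻¹ = d 1 g := by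
    rw [h.comm, (hg.pow_right N).inv_right.eq, h.eq_one, inv_mul_cancel_left]
  have e3 : d (g * t ^ N) g = d 1 (t ^ N) := by rw [h.comm, h.eq_one, inv_mul_cancel_left]
  have e4 : d (g * (t ^ N)⁻¹) g = d 1 (t ^ N) := by
    rw [h.comm, h.eq_one, inv_mul_cancel_left, h.inv]
  have e5 := h.tri 1 g (t ^ N)
  have e6 := h.tri 1 g (t ^ N)⁻¹
  rw [h.inv] at e6
  have c1 := h.comm g (t ^ N)
  have c2 := h.comm g (t ^ N)⁻¹
  exact h.near_axis_of_ends ax (N := N) (Or.inr ⟨rfl, rfl⟩) (by omega) (by omega)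

end IsHypMetric

end Metric

/-! ### Word metrics, axes in Cayley graphs, and minimality -/

section CayleyMetric

variable {G : Type u} [Group G]

theorem GenSet.mul_left (X : GenSet G) (g a b : G) :
    X.cayley.dist (g * a) (g * b) = X.cayley.dist a b :=
  dist_mul_left X.1 g a b

theorem GenSet.reachable_mul_left (X : GenSet G) (g : G) {a b : G} (h : X.cayley.Reachable a b) :
    X.cayley.Reachable (g * a) (g * b) :=
  h.map (leftMulIso X.1 g).toHom

theorem GenSet.reachable_of_mem (X : GenSet G) {x : G} (hx : x ∈ X.1) :
    X.cayley.Reachable 1 x := by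
  by_cases h : x = 1
  · rw [h]
  · exact SimpleGraph.Adj.reachable ((SimpleGraph.mulCayley_adj _ _ _).2 ⟨Ne.symm h, by simp [hx]⟩)

theorem GenSet.connected (X : GenSet G) : X.cayley.Connected := by
  have key : ∀ g : G, X.cayley.Reachable 1 g := by
    intro g
    have hg : g ∈ Subgroup.closure X.1 := by rw [X.2]; trivial
    induction hg using Subgroup.closure_induction with
    | mem x hx => exact X.reachable_of_mem hx
    | one => exact SimpleGraph.Reachable.refl _
    | mul x y _ _ hx hy =>
      have := X.reachable_mul_left x hy
      rw [mul_one] at this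
      exact hx.trans this
    | inv x _ hx =>
      have := X.reachable_mul_left x⁻¹ hx
      rw [mul_one, inv_mul_cancel] at this
      exact this.symm
  exact (SimpleGraph.connected_iff _).2 ⟨fun a b => (key a).symm.trans (key b), ⟨1⟩⟩

theorem GenSet.isInvMetric (X : GenSet G) : IsInvMetric X.cayley.dist where
  self _ := SimpleGraph.dist_self
  comm _ _ := SimpleGraph.dist_comm
  tri _ _ _ := X.connected.dist_triangle
  mul_left := X.mul_left

theorem GenSet.isHypMetric (X : GenSet G) {δ : ℕ} (h : FourPoint X.cayley δ) :
    IsHypMetric X.cayley.dist δ where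
  toIsInvMetric := X.isInvMetric
  four := h

theorem GenSet.dist_eq_one (X : GenSet G) (x y : G) :
    X.cayley.dist x y = X.cayley.dist 1 (x⁻¹ * y) := by
  rw [← X.mul_left x 1, mul_one, mul_inv_cancel_left]

/-- Domination of generating sets can be checked coarsely on word lengths. -/
theorem GenSet.le_of_coarse {X Y : GenSet G} (C : ℕ)
    (h : ∀ g, X.cayley.dist 1 g ≤ C * Y.cayley.dist 1 g + C) : X ≤ Y := by
  refine ⟨2 * C, fun x y => ?_⟩
  rw [X.dist_eq_one, Y.dist_eq_one]
  generalize x⁻¹ * y = g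
  by_cases hg : g = 1
  · simp [hg]
  · have h1 := Y.connected.pos_dist_of_ne (Ne.symm hg)
    have h2 := h g
    nlinarith

theorem GenSet.le_of_coarse_real {X Y : GenSet G} (C : ℝ)
    (h : ∀ g, (X.cayley.dist 1 g : ℝ) ≤ C * Y.cayley.dist 1 g + C) : X ≤ Y := by
  refine GenSet.le_of_coarse ⌈C⌉₊ fun g => ?_
  have h1 := h g
  have h2 := Nat.le_ceil C
  have h3 : C * (Y.cayley.dist 1 g : ℝ) ≤ ⌈C⌉₊ * Y.cayley.dist 1 g :=
    mul_le_mul_of_nonneg_right h2 (by positivity)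
  have h4 : (X.cayley.dist 1 g : ℝ) ≤ ⌈C⌉₊ * Y.cayley.dist 1 g + ⌈C⌉₊ := by linarith
  exact_mod_cast h4

theorem GenSet.exists_mul_of_le (X : GenSet G) (g : G) {n : ℕ} (hn : n ≤ X.cayley.dist 1 g) :
    ∃ a b, g = a * b ∧ X.cayley.dist 1 a = n ∧ X.cayley.dist 1 b = X.cayley.dist 1 g - n := by
  obtain ⟨p, hp⟩ := exists_geodesic X.connected 1 g
  have hp' : p.length = X.cayley.dist 1 g := hp
  have h1 := SimpleGraph.dist_le (p.take n)
  have h2 := SimpleGraph.dist_le (p.drop n)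
  have h3 : X.cayley.dist 1 g ≤ X.cayley.dist 1 (p.getVert n) + X.cayley.dist (p.getVert n) g :=
    X.connected.dist_triangle
  rw [SimpleGraph.Walk.take_length] at h1
  rw [SimpleGraph.Walk.drop_length] at h2
  refine ⟨p.getVert n, (p.getVert n)⁻¹ * g, by simp, by omega, ?_⟩
  rw [← X.dist_eq_one]
  omega

/-- A hyperbolic Cayley graph with nonempty boundary admits an element acting as a translation along
a quasi-geodesic line. -/
theorem GenSet.exists_strong (X : GenSet G) {δ : ℕ} (h : FourPoint X.cayley δ)
    (hne : Nonempty (Boundary X.cayley)) :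
    ∃ t, X.cayley.dist 1 t + 2 * δ + 1 ≤ X.cayley.dist 1 (t * t) := by
  obtain ⟨ξ⟩ := hne
  obtain ⟨x, hx, -⟩ := exists_boundaryPoint ξ
  -- Only the existence of long elements is extracted from the boundary point. A geodesic word of
  -- length 2n, with n = 4δ + 1, is then cut into halves a and b.
  obtain ⟨N, hN⟩ := fellow_iff.1 hx 1 (2 * (2 * (4 * δ + 1)))
  have h1 := hN N le_rfl N le_rfl
  rw [SimpleGraph.dist_self, SimpleGraph.dist_comm] at h1
  obtain ⟨c, -, -, hc, -⟩ := X.exists_mul_of_le (x N) (n := 2 * (4 * δ + 1)) (by omega)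
  obtain ⟨a, b, rfl, ha, hb⟩ := X.exists_mul_of_le c (n := 4 * δ + 1) (by omega)
  exact (X.isHypMetric h).exists_strong_of_geodesic ha (by omega) hc le_rfl

section Axis

variable {X : GenSet G} {δ : ℕ} (h : IsHypMetric X.cayley.dist δ) {t : G} {K : ℕ}
  (ax : IsAxial X.cayley.dist t K)
include h ax

theorem axis_gromov (i j : ℕ) : 2 * min i j + X.cayley.dist (t ^ i) (t ^ j) ≤
    X.cayley.dist 1 (t ^ i) + X.cayley.dist 1 (t ^ j) + K := by
  wlog hij : i ≤ j generalizing i j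
  · have := this j i (by omega)
    rw [h.comm (t ^ i), min_comm]
    omega
  · have h1 := ax.add i (j - i)
    rw [Nat.add_sub_cancel' hij] at h1
    have h2 := ax.le i
    rw [h.pow_pow hij, min_eq_left hij]
    omega

theorem axis_inv : IsAxial X.cayley.dist t⁻¹ K where
  le n := by rw [inv_pow, h.inv]; exact ax.le n
  add m n := by simpa only [inv_pow, h.inv] using ax.add m n

theorem fellow_axis : Fellow X.cayley (fun n => t ^ n) (fun n => t ^ n) := by
  refine fellow_of_base X.connected 1 fun M => ⟨M + K, fun i hi j hj => ?_⟩
  have h1 := axis_gromov h ax i j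
  have h2 : M + K ≤ min i j := le_min hi hj
  rw [h.comm _ 1, h.comm _ 1]
  omega

theorem fellow_axis_inv : Fellow X.cayley (fun n => (t ^ n)⁻¹) (fun n => (t ^ n)⁻¹) := by
  simpa only [inv_pow] using fellow_axis h (axis_inv h ax)

theorem not_fellow_axis : ¬ Fellow X.cayley (fun n => t ^ n) (fun n => (t ^ n)⁻¹) := by
  intro hf
  obtain ⟨N, hN⟩ := fellow_iff.1 hf 1 (K + 1)
  have h1 := hN N le_rfl N le_rfl
  have h2 := h.axis_between ax 1 N
  simp only [one_mul] at h2
  rw [h.comm (t ^ N) 1, h.comm _ 1, h.comm (t ^ N)] at h1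
  omega

theorem boundary_nonempty : Nonempty (Boundary X.cayley) := ⟨boundaryPoint (fellow_axis h ax)⟩

/-- If the boundary has two points, then every group element is close to the axis. -/
theorem near_axis_of_card (hcard : Nat.card (Boundary X.cayley) = 2) (g : G) :
    ∃ k : ℤ, X.cayley.dist g (t ^ k) ≤ X.cayley.dist 1 t + K + (K + 2 * δ) + δ := by
  set ξ := boundaryPoint (fellow_axis h ax) with hξ
  set η := boundaryPoint (fellow_axis_inv h ax) with hη
  have four : FourPoint X.cayley δ := h.four
  have hne : ξ ≠ η := fun he => not_fellow_axis h ax (four.fellow_of_boundaryPoint_eq he)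
  obtain ⟨η', -, huniq⟩ := (Nat.card_eq_two_iff' ξ).1 hcard
  have two : ∀ ζ, ζ ≠ ξ → ζ = η := fun ζ hζ => (huniq ζ hζ).trans (huniq η hne.symm).symm
  have hg : g • ξ ≠ g • η := fun he => hne (MulAction.injective g he)
  have hξ' : g • ξ = boundaryPoint (fellow_mul_left X.1 g (fellow_axis h ax)) := rfl
  have hη' : g • η = boundaryPoint (fellow_mul_left X.1 g (fellow_axis_inv h ax)) := rfl
  have main : ∀ y y' : ℕ → G, (∀ N, (y N = t ^ N ∧ y' N = (t ^ N)⁻¹) ∨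
      (y N = (t ^ N)⁻¹ ∧ y' N = t ^ N)) → Fellow X.cayley (fun n => g * (t ^ n)⁻¹) y →
      Fellow X.cayley (fun n => g * t ^ n) y' →
      ∃ k : ℤ, X.cayley.dist g (t ^ k) ≤ X.cayley.dist 1 t + K + (K + 2 * δ) + δ := by
    intro y y' hy h1 h2
    obtain ⟨N₁, hN₁⟩ := fellow_iff.1 h1 g (K + δ + 1)
    obtain ⟨N₂, hN₂⟩ := fellow_iff.1 h2 g (K + 2 * δ + 1)
    have h3 := hN₁ _ (le_max_left N₁ N₂) _ (le_max_left N₁ N₂)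
    have h4 := hN₂ _ (le_max_right N₁ N₂) _ (le_max_right N₁ N₂)
    exact h.near_axis_of_ends ax (hy (max N₁ N₂)) (by omega) (by omega)
  -- The element g permutes the two ends of the axis, so it fixes both or swaps them. Either way the
  -- ends of the translated axis fellow-travel with those of the axis.
  by_cases hcase : g • ξ = ξ
  · have hcase' : g • η = η := two _ (by rw [← hcase]; exact hg.symm)
    rw [hξ'] at hcase
    rw [hη'] at hcase'
    exact main (fun n => (t ^ n)⁻¹) (fun n => t ^ n) (fun N => Or.inr ⟨rfl, rfl⟩)
      (four.fellow_of_boundaryPoint_eq hcase') (four.fellow_of_boundaryPoint_eq hcase)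
  · have h1 : g • ξ = η := two _ hcase
    have h2 : g • η = ξ := by
      by_contra hcon
      exact hg (h1.trans (two _ hcon).symm)
    rw [hξ'] at h1
    rw [hη'] at h2
    exact main (fun n => t ^ n) (fun n => (t ^ n)⁻¹) (fun N => Or.inl ⟨rfl, rfl⟩)
      (four.fellow_of_boundaryPoint_eq h2) (four.fellow_of_boundaryPoint_eq h1)

end Axis

/-! ### Minimality of lineal structures -/

theorem GenSet.toClass_le {X Y : GenSet G} : X.toClass ≤ Y.toClass ↔ X ≤ Y := Iff.rfl

theorem GenSet.le_of_toClass_eq {X Y : GenSet G} (h : X.toClass = Y.toClass) : X ≤ Y :=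
  GenSet.toClass_le.1 h.le

theorem boundary_nonempty_of_growth {X : GenSet G} {δ : ℕ} (h : FourPoint X.cayley δ) {g : G}
    {c : ℕ} (hg : ∀ n : ℕ, n ≤ c * X.cayley.dist 1 (g ^ n)) : Nonempty (Boundary X.cayley) := by
  obtain ⟨m, -, hm⟩ := exists_pow_displacement δ hg
  exact boundary_nonempty (X.isHypMetric h) ((X.isHypMetric h).isAxial hm)

/-- Ellipticity is witnessed by some representative Y of the class, possibly not X. Linear growth of
the powers of an element passes from X to Y and produces a boundary point for Y. -/
theorem toClass_notMem_elliptic {X : GenSet G} (hX : IsHyperbolicGraph X.cayley)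
    (hne : Nonempty (Boundary X.cayley)) : X.toClass ∉ ellipticStructures G := by
  rintro ⟨Y, hY, hYh, hYe⟩
  obtain ⟨δ, hδ⟩ := hX.fourPoint
  obtain ⟨δ', hδ'⟩ := hYh.fourPoint
  obtain ⟨t, ht⟩ := X.exists_strong hδ hne
  obtain ⟨C, hC⟩ := GenSet.le_of_toClass_eq hY.symm
  have ax := (X.isHypMetric hδ).isAxial ht
  have := boundary_nonempty_of_growth hδ' (g := t) (c := C)
    fun n => (ax.le n).trans (hC 1 (t ^ n))
  exact (not_isEmpty_iff.2 this) hYe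

/-- Powers of a Y-axial s grow linearly for Y, hence for the larger metric of X, so some s^m is
axial for X. Every g is X-close, hence Y-close, to some s^(mk); then |k| is at most the Y-length of
g plus a constant, and it bounds the X-length of g linearly. -/
theorem le_of_lineal {X Y : GenSet G} (hX : IsHyperbolicGraph X.cayley)
    (hcard : Nat.card (Boundary X.cayley) = 2) (hY : IsHyperbolicGraph Y.cayley)
    (hne : Nonempty (Boundary Y.cayley)) (hYX : Y ≤ X) : X ≤ Y := by
  obtain ⟨δ, hδ⟩ := hX.fourPoint
  obtain ⟨δ', hδ'⟩ := hY.fourPoint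
  obtain ⟨s, hs⟩ := Y.exists_strong hδ' hne
  obtain ⟨C, hC⟩ := hYX
  have axs := (Y.isHypMetric hδ').isAxial hs
  obtain ⟨m, hm1, hm⟩ := exists_pow_displacement (d := X.cayley.dist) δ (g := s) (c := C)
    fun n => (axs.le n).trans (hC 1 (s ^ n))
  have hX' := X.isHypMetric hδ
  have hY' := Y.isHypMetric hδ'
  have ax := hX'.isAxial hm
  have hnear := near_axis_of_card hX' ax hcard
  set R := X.cayley.dist 1 (s ^ m) + (X.cayley.dist 1 (s ^ m) + δ) +
    (X.cayley.dist 1 (s ^ m) + δ + 2 * δ) + δ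
  set A := X.cayley.dist 1 (s ^ m)
  refine GenSet.le_of_coarse (A * (C * R) + A + R) fun g => ?_
  obtain ⟨k, hk⟩ := hnear g
  have h1 := hX'.tri 1 ((s ^ m) ^ k) g
  rw [hX'.comm ((s ^ m) ^ k) g] at h1
  have h2 := hX'.zpow_le (s ^ m) k
  have h3 : k.natAbs ≤ Y.cayley.dist 1 ((s ^ m) ^ k) := by
    rw [hY'.zpow_natAbs, ← pow_mul]
    exact (Nat.le_mul_of_pos_left _ hm1).trans (axs.le _)
  have h4 := hY'.tri 1 g ((s ^ m) ^ k)
  have h5 := hC g ((s ^ m) ^ k)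
  have h6 := Nat.mul_le_mul_left C hk
  have h7 : k.natAbs ≤ Y.cayley.dist 1 g + C * R := by omega
  have h8 := Nat.mul_le_mul_right A h7
  change X.cayley.dist 1 ((s ^ m) ^ k) ≤ k.natAbs * A at h2
  nlinarith [Nat.zero_le (A * (C * R) * Y.cayley.dist 1 g), Nat.zero_le (R * Y.cayley.dist 1 g)]

theorem isMinimal_of_lineal {A : GenClass G} (hA : A ∈ linealStructures G) :
    IsMinimalStructure G A := by
  obtain ⟨X, rfl, hX, hcard⟩ := hA
  have hne : Nonempty (Boundary X.cayley) := by
    refine (Nat.card_pos_iff.1 ?_).1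
    omega
  refine ⟨⟨⟨X, rfl, hX⟩, toClass_notMem_elliptic hX hne⟩, ?_⟩
  rintro _ ⟨⟨Y, rfl, hY⟩, hYe⟩ hYX
  refine GenSet.toClass_le.2 (le_of_lineal hX hcard hY ?_ (GenSet.toClass_le.1 hYX))
  by_contra hcon
  exact hYe ⟨Y, rfl, hY, not_nonempty_iff.1 hcon⟩

theorem isAntichain_lineal : IsAntichain (· ≤ ·) (linealStructures G) := by
  intro A hA B hB hne hAB
  exact hne (le_antisymm hAB ((isMinimal_of_lineal hB).2 (isMinimal_of_lineal hA).1 hAB))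

theorem orientable_subset_lineal : orientableLinealStructures G ⊆ linealStructures G := by
  rintro _ ⟨X, rfl, hX, hcard, -⟩
  exact ⟨X, rfl, hX, hcard⟩

end CayleyMetric

/-! ### Quasimorphisms and the lineal structures they define -/

section Quasimorphisms

variable {G : Type u} [Group G]

/-- Quasimorphisms with defect at most `D`. -/
def IsQuasimorphism (φ : G → ℝ) (D : ℝ) : Prop := ∀ g h, |φ (g * h) - φ g - φ h| ≤ D

namespace IsQuasimorphism

variable {φ ψ : G → ℝ} {D E : ℝ}

theorem add_smul (hφ : IsQuasimorphism φ D) (hψ : IsQuasimorphism ψ E) (s : ℝ) :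
    IsQuasimorphism (fun g => φ g + s * ψ g) (D + |s| * E) := by
  intro g h
  have h1 := hφ g h
  have h2 : |s * (ψ (g * h) - ψ g - ψ h)| ≤ |s| * E := by
    rw [abs_mul]; exact mul_le_mul_of_nonneg_left (hψ g h) (abs_nonneg s)
  calc _ = |(φ (g * h) - φ g - φ h) + s * (ψ (g * h) - ψ g - ψ h)| := by congr 1; ring
    _ ≤ _ := (abs_add_le _ _).trans (add_le_add h1 h2)

theorem map_one (hφ : IsQuasimorphism φ D) : |φ 1| ≤ D := by
  have := hφ 1 1
  rw [mul_one, sub_self, zero_sub, abs_neg] at this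
  exact this

theorem map_inv_mul (hφ : IsQuasimorphism φ D) (g h : G) :
    |φ (g⁻¹ * h) - (φ h - φ g)| ≤ D := by
  have := hφ g (g⁻¹ * h)
  rw [mul_inv_cancel_left] at this
  rwa [← abs_neg, neg_sub]

theorem map_pow (hφ : IsQuasimorphism φ D) (g : G) (n : ℕ) :
    |φ (g ^ (n + 1)) - (n + 1) * φ g| ≤ n * D := by
  induction n with
  | zero => simp
  | succ n ih =>
    have h1 := hφ (g ^ (n + 1)) g
    rw [← pow_succ] at h1
    push_cast
    rw [abs_le] at *
    constructor <;> linarith [ih.1, ih.2, h1.1, h1.2]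

/-- A quasimorphism is close to a homomorphism on every cyclic subgroup. -/
theorem exists_slope (hφ : IsQuasimorphism φ D) (g : G) :
    ∃ c : ℝ, ∀ k : ℤ, |φ (g ^ k) - c * k| ≤ 3 * D := by
  have hD : 0 ≤ D := (abs_nonneg _).trans hφ.map_one
  -- Both sides are compared with φ(g^((m+1)(n+1))) / ((m+1)(n+1)). Hence the supremum c of the left
  -- sides lies below all right sides.
  have key : ∀ m n : ℕ, (φ (g ^ (n + 1)) - D) / (n + 1) ≤ (φ (g ^ (m + 1)) + D) / (m + 1) := by
    intro m n
    have h1 := abs_le.1 (hφ.map_pow (g ^ (n + 1)) m)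
    have h2 := abs_le.1 (hφ.map_pow (g ^ (m + 1)) n)
    rw [← pow_mul] at h1 h2
    rw [mul_comm (m + 1)] at h2
    rw [div_le_div_iff₀ (by positivity) (by positivity)]
    nlinarith [h1.1, h2.2]
  set c := ⨆ n : ℕ, (φ (g ^ (n + 1)) - D) / (n + 1) with hc
  have bdd : BddAbove (Set.range fun n : ℕ => (φ (g ^ (n + 1)) - D) / (n + 1)) :=
    ⟨_, by rintro _ ⟨n, rfl⟩; exact key 0 n⟩
  have h1 : ∀ n : ℕ, |φ (g ^ (n + 1)) - c * (n + 1)| ≤ D := by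
    intro n
    have h2 : (φ (g ^ (n + 1)) - D) / (n + 1) ≤ c := le_ciSup bdd n
    have h3 : c ≤ (φ (g ^ (n + 1)) + D) / (n + 1) := ciSup_le fun m => key n m
    rw [div_le_iff₀ (by positivity)] at h2
    rw [le_div_iff₀ (by positivity)] at h3
    rw [abs_le]
    constructor <;> linarith
  have h2 : ∀ n : ℕ, |φ (g ^ n) - c * n| ≤ D := by
    intro n
    cases n with
    | zero => simpa using hφ.map_one
    | succ n => push_cast; exact h1 n
  refine ⟨c, fun k => ?_⟩
  obtain ⟨n, rfl | rfl⟩ := k.eq_nat_or_neg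
  · rw [zpow_natCast, Int.cast_natCast]
    linarith [h2 n]
  · have h3 := abs_le.1 (hφ (g ^ n)⁻¹ (g ^ n))
    have h4 := abs_le.1 hφ.map_one
    have h5 := abs_le.1 (h2 n)
    rw [inv_mul_cancel] at h3
    rw [zpow_neg, zpow_natCast, abs_le]
    push_cast
    constructor <;> linarith [h3.1, h3.2, h4.1, h4.2, h5.1, h5.2]

/-- Slope 0 would force |φ g| ≤ 3D, so any g violating this bound has nonzero slope; passing to the
inverse makes it positive. -/
theorem exists_slope_ne_zero (hφ : IsQuasimorphism φ D) (hub : ¬ ∃ B, ∀ g, |φ g| ≤ B) :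
    ∃ (g : G) (c : ℝ), 0 < c ∧ ∀ k : ℤ, |φ (g ^ k) - c * k| ≤ 3 * D := by
  push Not at hub
  obtain ⟨g, hg⟩ := hub (3 * D)
  obtain ⟨c, hc⟩ := hφ.exists_slope g
  rcases lt_trichotomy c 0 with h0 | h0 | h0
  · refine ⟨g⁻¹, -c, by linarith, fun k => ?_⟩
    have := hc (-k)
    rw [inv_zpow', neg_mul, ← mul_neg]
    push_cast at this
    exact this
  · have := hc 1
    rw [h0, zpow_one, zero_mul, sub_zero] at this
    linarith
  · exact ⟨g, c, h0, hc⟩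

/-- A quasimorphism that is dominated by an unbounded one is, up to a bounded error, a multiple of
it. -/
theorem exists_proportional (hφ : IsQuasimorphism φ D) (hψ : IsQuasimorphism ψ E)
    (hub : ¬ ∃ B, ∀ g, |φ g| ≤ B) {C : ℝ} (hC : ∀ g, |ψ g| ≤ C * |φ g| + C) :
    ∃ s B : ℝ, ∀ g, |ψ g - s * φ g| ≤ B := by
  obtain ⟨g₀, a, ha, hg₀⟩ := hφ.exists_slope_ne_zero hub
  obtain ⟨b, hb⟩ := hψ.exists_slope g₀
  have hC0 : 0 ≤ C := by
    by_contra hcon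
    have h1 := hC 1
    have := abs_nonneg (ψ 1)
    nlinarith [abs_nonneg (φ 1)]
  -- The factor is the ratio of the slopes on the powers of g₀. Dividing h by a suitable power
  -- leaves a remainder on which φ, and therefore ψ, is bounded.
  refine ⟨b / a, (C * (a + 3 * D + D) + C) + E + 3 * E + |b / a| * a, fun h => ?_⟩
  set k : ℤ := ⌊φ h / a⌋
  have h1 : |φ h - a * k| ≤ a := by
    have e : φ h = a * (φ h / a) := by field_simp
    have f1 := Int.floor_le (φ h / a)
    have f2 := (Int.lt_floor_add_one (φ h / a)).le
    rw [abs_le]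
    constructor <;> nlinarith
  have h2 := hφ.map_inv_mul (g₀ ^ k) h
  have h3 := hψ.map_inv_mul (g₀ ^ k) h
  have h4 := hC ((g₀ ^ k)⁻¹ * h)
  have h5 : |φ ((g₀ ^ k)⁻¹ * h)| ≤ a + 3 * D + D := by
    have := abs_le.1 (hg₀ k)
    rw [abs_le] at *
    constructor <;> linarith [h1.1, h1.2, h2.1, h2.2, this.1, this.2]
  have h6 : |ψ ((g₀ ^ k)⁻¹ * h)| ≤ C * (a + 3 * D + D) + C :=
    h4.trans (by linarith [mul_le_mul_of_nonneg_left h5 hC0])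
  have h7 : |b / a * (a * k - φ h)| ≤ |b / a| * a := by
    rw [abs_mul, abs_sub_comm]
    exact mul_le_mul_of_nonneg_left h1 (abs_nonneg _)
  have h8 : b / a * (a * k - φ h) = b * k - b / a * φ h := by field_simp
  rw [h8] at h7
  have h9 := abs_le.1 (hb k)
  rw [abs_le] at *
  constructor <;> linarith [h3.1, h3.2, h6.1, h6.2, h7.1, h7.2, h9.1, h9.2]

end IsQuasimorphism

/-! ### Generating sets defined by coarse lines -/

/-- A function on `G` that behaves like an orbit map of an action on the real line, with some
element acting as a translation, is a quasi-isometry for the word metric of some generating set. -/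
theorem exists_isQuasiLine {φ : G → ℝ} {D a B : ℝ} {g₀ : G} (ha : 0 < a)
    (hφ : ∀ g h, |(|φ (g⁻¹ * h)| - |φ h - φ g|)| ≤ D)
    (hg₀ : ∀ k : ℤ, |φ (g₀ ^ k) - a * k| ≤ B) :
    ∃ (X : GenSet G) (L : ℝ), IsQuasiLine X.cayley φ L := by
  have hD : 0 ≤ D := (abs_nonneg _).trans (hφ 1 1)
  have hB : 0 ≤ B := (abs_nonneg _).trans (hg₀ 0)
  -- Division with remainder by g₀. The generating set is a sublevel set of |φ| containing g₀ and
  -- all remainders. Only |φ(g⁻¹h)| is controlled by the hypothesis, so actions that flip the line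
  -- are allowed.
  have hdec : ∀ h, ∃ k : ℤ, (k.natAbs : ℝ) ≤ |φ h| / a + 1 ∧
      |φ ((g₀ ^ k)⁻¹ * h)| ≤ a + B + D := by
    intro h
    refine ⟨⌊φ h / a⌋, ?_, ?_⟩
    · rw [Nat.cast_natAbs, Int.cast_abs]
      have f1 := Int.floor_le (φ h / a)
      have f2 := (Int.lt_floor_add_one (φ h / a)).le
      have f3 : |φ h| / a = |φ h / a| := by rw [abs_div, abs_of_pos ha]
      rw [f3]
      have f4 := neg_abs_le (φ h / a)
      have f5 := le_abs_self (φ h / a)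
      rw [abs_le]
      constructor <;> linarith
    · set k : ℤ := ⌊φ h / a⌋
      have h1 : |φ h - a * k| ≤ a := by
        have e : φ h = a * (φ h / a) := by field_simp
        have f1 := Int.floor_le (φ h / a)
        have f2 := (Int.lt_floor_add_one (φ h / a)).le
        rw [abs_le]
        constructor <;> nlinarith
      have h2 := (abs_le.1 (hφ (g₀ ^ k) h)).2
      have h3 : |φ h - φ (g₀ ^ k)| ≤ a + B := by
        have := hg₀ k
        rw [abs_le] at *
        constructor <;> linarith [h1.1, h1.2, this.1, this.2]
      linarith
  have hmem : g₀ ∈ {g | |φ g| ≤ a + B + D} := by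
    have := hg₀ 1
    rw [zpow_one, Int.cast_one, mul_one] at this
    change |φ g₀| ≤ a + B + D
    rw [abs_le] at *
    constructor <;> linarith [this.1, this.2]
  have hgen : Subgroup.closure {g | |φ g| ≤ a + B + D} = ⊤ := by
    refine Subgroup.eq_top_iff' _ |>.2 fun h => ?_
    obtain ⟨k, -, hk⟩ := hdec h
    rw [← mul_inv_cancel_left (g₀ ^ k) h]
    exact mul_mem (zpow_mem (Subgroup.subset_closure hmem) k) (Subgroup.subset_closure hk)
  let X : GenSet G := ⟨_, hgen⟩
  have hX := X.isInvMetric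
  have hone : ∀ g, |φ g| ≤ a + B + D → X.cayley.dist 1 g ≤ 1 := by
    intro g hg
    by_cases h1 : g = 1
    · simp [h1]
    · exact (SimpleGraph.dist_eq_one_iff_adj.2 ((SimpleGraph.mulCayley_adj _ _ _).2
        ⟨Ne.symm h1, Or.inl (by rw [inv_one, one_mul]; exact hg)⟩)).le
  have h0 : 0 ≤ 1 / a := by positivity
  have h0' : 0 ≤ D / a := by positivity
  refine ⟨X, 1 / a + D / a + 2 + (a + B + D + D), X.connected, by linarith, ?_, ?_⟩
  · intro x y hxy
    have hXdef : X.cayley.Adj x y ↔ _ := SimpleGraph.mulCayley_adj _ _ _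
    obtain ⟨-, h1 | h1⟩ := hXdef.1 hxy
    · have h1 : |φ (x⁻¹ * y)| ≤ a + B + D := h1
      have h2 := (abs_le.1 (hφ x y)).1
      rw [abs_sub_comm]
      linarith
    · have h1 : |φ (y⁻¹ * x)| ≤ a + B + D := h1
      have h2 := (abs_le.1 (hφ y x)).1
      linarith
  · intro x y
    rw [X.dist_eq_one]
    obtain ⟨k, hk1, hk2⟩ := hdec (x⁻¹ * y)
    have h1 := hX.mul_le (g₀ ^ k) ((g₀ ^ k)⁻¹ * (x⁻¹ * y))
    rw [mul_inv_cancel_left] at h1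
    have h2 := hone _ hk2
    have h3 := hX.zpow_le g₀ k
    have h4 := Nat.mul_le_mul_left k.natAbs (hone _ hmem)
    have h5 : (X.cayley.dist 1 (x⁻¹ * y) : ℝ) ≤ k.natAbs + 1 := by
      have : X.cayley.dist 1 (x⁻¹ * y) ≤ k.natAbs + 1 := by omega
      exact_mod_cast this
    have h6 := (abs_le.1 (hφ x y)).2
    rw [abs_sub_comm (φ y)] at h6
    have h7 : |φ (x⁻¹ * y)| / a ≤ (|φ x - φ y| + D) / a :=
      div_le_div_of_nonneg_right (by linarith) ha.le
    have e7 : (|φ x - φ y| + D) / a = 1 / a * |φ x - φ y| + D / a := by ring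
    have h8 : 0 ≤ (D / a + 2 + (a + B + D + D)) * |φ x - φ y| := by positivity
    linarith

theorem unbounded_of_slope {φ : G → ℝ} {a B : ℝ} {g₀ : G} (ha : 0 < a)
    (hg₀ : ∀ k : ℤ, |φ (g₀ ^ k) - a * k| ≤ B) :
    (∀ R, ∃ g, R ≤ φ g) ∧ ∀ R, ∃ g, φ g ≤ R := by
  constructor
  · intro R
    refine ⟨g₀ ^ ⌈(R + B) / a⌉, ?_⟩
    have h1 := abs_le.1 (hg₀ ⌈(R + B) / a⌉)
    have h2 := Int.le_ceil ((R + B) / a)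
    rw [div_le_iff₀ ha] at h2
    linarith [h1.1]
  · intro R
    refine ⟨g₀ ^ ⌊(R - B) / a⌋, ?_⟩
    have h1 := abs_le.1 (hg₀ ⌊(R - B) / a⌋)
    have h2 := Int.floor_le ((R - B) / a)
    rw [le_div_iff₀ ha] at h2
    linarith [h1.2]

theorem IsQuasiLine.smul_eq_of_quasimorphism {X : GenSet G} {φ : G → ℝ} {L D : ℝ}
    (h : IsQuasiLine X.cayley φ L) (hφ : IsQuasimorphism φ D)
    (hu : ∀ R, ∃ g, R ≤ φ g) (hd : ∀ R, ∃ g, φ g ≤ R) (g : G) (ξ : Boundary X.cayley) :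
    g • ξ = ξ := by
  obtain ⟨z, hz, rfl⟩ := exists_boundaryPoint ξ
  have h1 : g • boundaryPoint hz = boundaryPoint (fellow_mul_left X.1 g hz) := rfl
  rw [h1]
  refine boundaryPoint_eq _ _ ?_
  rcases h.tendsto_of_fellow hu hd hz with ⟨h2, -⟩ | ⟨h2, -⟩
  · refine h.fellow_of_tendsto (Filter.tendsto_atTop_mono (fun n => ?_)
      (Filter.tendsto_atTop_add_const_right _ (φ g - D) h2)) h2
    have := (abs_le.1 (hφ g (z n))).1
    linarith
  · refine h.fellow_of_tendsto_atBot (Filter.tendsto_atBot_mono (fun n => ?_)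
      (Filter.tendsto_atBot_add_const_right _ (φ g + D) h2)) h2
    have := (abs_le.1 (hφ g (z n))).2
    linarith

/-- Every unbounded quasimorphism determines an orientable lineal structure. -/
theorem IsQuasimorphism.exists_orientable {φ : G → ℝ} {D : ℝ} (hφ : IsQuasimorphism φ D)
    (hub : ¬ ∃ B, ∀ g, |φ g| ≤ B) :
    ∃ (X : GenSet G) (L : ℝ), X.toClass ∈ orientableLinealStructures G ∧
      IsQuasiLine X.cayley φ L := by
  obtain ⟨g₀, a, ha, hg₀⟩ := hφ.exists_slope_ne_zero hub
  obtain ⟨X, L, hX⟩ := exists_isQuasiLine ha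
    (fun g h => (abs_abs_sub_abs_le_abs_sub _ _).trans (hφ.map_inv_mul g h)) hg₀
  obtain ⟨hu, hd⟩ := unbounded_of_slope ha hg₀
  exact ⟨X, L, ⟨X, rfl, hX.isHyperbolicGraph, hX.card_boundary hu hd,
    hX.smul_eq_of_quasimorphism hφ hu hd⟩, hX⟩

end Quasimorphisms

/-! ### Busemann quasimorphisms and the number of orientable structures -/

section Busemann

variable {G : Type u} [Group G]

theorem IsHypMetric.busemann_close {d : G → G → ℕ} {δ : ℕ} (h : IsHypMetric d δ) {g x y : G}
    (hxy : 2 * d 1 g + δ + 1 + d x y ≤ d x 1 + d y 1) :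
    |((d g x : ℤ) - d 1 x) - ((d g y : ℤ) - d 1 y)| ≤ δ := by
  have h1 := h.four g x 1 y
  have h2 := h.four g y 1 x
  have h3 := h.tri 1 g x
  have h4 := h.tri 1 g y
  have c1 := h.comm g 1
  have c2 := h.comm x 1
  have c3 := h.comm y 1
  have c4 := h.comm x y
  rw [abs_le]
  omega

/-- The word length of an orientable lineal structure is, up to a bounded error, the absolute value
of a quasimorphism. -/
theorem exists_quasimorphism_of_orientable {X : GenSet G} (hX : IsHyperbolicGraph X.cayley)
    (hcard : Nat.card (Boundary X.cayley) = 2)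
    (hfix : ∀ (g : G) (ξ : Boundary X.cayley), g • ξ = ξ) :
    ∃ (φ : G → ℝ) (D : ℝ), IsQuasimorphism φ D ∧
      ∀ g, (X.cayley.dist 1 g : ℝ) ≤ |φ g| + D ∧ |φ g| ≤ X.cayley.dist 1 g + D := by
  obtain ⟨δ, hδ⟩ := hX.fourPoint
  have h := X.isHypMetric hδ
  have hne : Nonempty (Boundary X.cayley) := by
    refine (Nat.card_pos_iff.1 ?_).1
    omega
  obtain ⟨t, ht⟩ := X.exists_strong hδ hne
  obtain ⟨K, ax⟩ : ∃ K, IsAxial X.cayley.dist t K := ⟨_, h.isAxial ht⟩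
  obtain ⟨R, hR⟩ : ∃ R, ∀ g, ∃ k : ℤ, X.cayley.dist g (t ^ k) ≤ R :=
    ⟨_, near_axis_of_card h ax hcard⟩
  set d := X.cayley.dist with hd
  -- An approximate Busemann function at the end of the powers of t⁻¹. It need not converge in N,
  -- but it is eventually constant up to δ, so φ g is its value at one late index.
  set b : G → ℕ → ℤ := fun g N => (d g (t ^ N)⁻¹ : ℤ) - d 1 (t ^ N)⁻¹ with hb
  have hη := fellow_axis_inv h ax
  have hev : ∀ g, ∃ N₀, ∀ N ≥ N₀, ∀ N' ≥ N₀, |b g N - b g N'| ≤ δ := by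
    intro g
    obtain ⟨N₀, hN₀⟩ := fellow_iff.1 hη 1 (2 * d 1 g + δ + 1)
    exact ⟨N₀, fun N hN N' hN' => h.busemann_close (hN₀ N hN N' hN')⟩
  choose N₀ hN₀ using hev
  have hφ : ∀ g, ∀ N ≥ N₀ g, |b g (N₀ g) - b g N| ≤ δ := fun g N hN => hN₀ g _ le_rfl N hN
  generalize hφ' : (fun g => b g (N₀ g)) = φ at *
  have hφ : ∀ g, ∀ N ≥ N₀ g, |φ g - b g N| ≤ δ := by rw [← hφ']; exact hφ
  -- The end is fixed by g⁻¹, so measuring g' against g⁻¹t^(-N) instead of t^(-N) changes little;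
  -- the former value is exactly b(gg') - b(g).
  have hqm : ∀ g g', |φ (g * g') - φ g - φ g'| ≤ 4 * δ := by
    intro g g'
    have hf : Fellow X.cayley (fun n => g⁻¹ * (t ^ n)⁻¹) (fun n => (t ^ n)⁻¹) := by
      refine FourPoint.fellow_of_boundaryPoint_eq hδ
        (hx := fellow_mul_left X.1 g⁻¹ hη) (hy := hη) ?_
      exact hfix g⁻¹ (boundaryPoint hη)
    obtain ⟨M, hM⟩ := fellow_iff.1 hf 1 (2 * d 1 g' + δ + 1)
    set N := max M (max (N₀ g) (max (N₀ g') (N₀ (g * g'))))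
    have h1 := h.busemann_close (hM N (by omega) N (by omega))
    have h2 := hφ g N (by omega)
    have h3 := hφ g' N (by omega)
    have h4 := hφ (g * g') N (by omega)
    have e1 : d g' (g⁻¹ * (t ^ N)⁻¹) = d (g * g') (t ^ N)⁻¹ := by
      rw [← h.mul_left g, mul_inv_cancel_left]
    have e2 : d 1 (g⁻¹ * (t ^ N)⁻¹) = d g (t ^ N)⁻¹ := by
      rw [← h.mul_left g, mul_inv_cancel_left, mul_one]
    change |((d g' (g⁻¹ * (t ^ N)⁻¹) : ℤ) - d 1 (g⁻¹ * (t ^ N)⁻¹)) -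
      ((d g' (t ^ N)⁻¹ : ℤ) - d 1 (t ^ N)⁻¹)| ≤ δ at h1
    rw [e1, e2] at h1
    simp only [hb] at h2 h3 h4
    rw [abs_le] at *
    omega
  have hup : ∀ g, |φ g| ≤ d 1 g + δ := by
    intro g
    have h1 := hφ g (N₀ g) le_rfl
    have h2 := h.tri 1 g (t ^ N₀ g)⁻¹
    have h3 := h.tri g 1 (t ^ N₀ g)⁻¹
    have h4 := h.comm g 1
    simp only [hb] at h1
    change d 1 (t ^ N₀ g)⁻¹ ≤ d 1 g + d g (t ^ N₀ g)⁻¹ at h2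
    change d g (t ^ N₀ g)⁻¹ ≤ d g 1 + d 1 (t ^ N₀ g)⁻¹ at h3
    rw [abs_le] at *
    omega
  -- It suffices to look at the nearby t^k. For k ≥ 0 the identity lies between t^(-N) and t^k, for
  -- k ≤ 0 the point t^k lies between t^(-N) and 1; so b(t^k) is about d(1, t^k) or its negative.
  have hlo : ∀ g, (d 1 g : ℤ) ≤ |φ g| + (δ + 2 * R + K) := by
    intro g
    obtain ⟨k, hk⟩ := hR g
    set N := max (N₀ g) k.natAbs
    have h1 := hφ g N (by omega)
    have h2 : d g (t ^ N)⁻¹ ≤ d g (t ^ k) + d (t ^ k) (t ^ N)⁻¹ := h.tri _ _ _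
    have h3 : d (t ^ k) (t ^ N)⁻¹ ≤ d (t ^ k) g + d g (t ^ N)⁻¹ := h.tri _ _ _
    have h4 : d 1 g ≤ d 1 (t ^ k) + d (t ^ k) g := h.tri _ _ _
    have h5 : d (t ^ k) g = d g (t ^ k) := h.comm _ _
    have h6 : d 1 (t ^ N)⁻¹ = d 1 (t ^ N) := h.inv _
    have h7 : d (t ^ k) (t ^ N)⁻¹ = d 1 (t ^ (-(N : ℤ) - k).natAbs) := by
      rw [← h.zpow_zpow, zpow_neg, zpow_natCast]
    have h8 : d 1 (t ^ k) = d 1 (t ^ k.natAbs) := h.zpow_natAbs _ _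
    simp only [hb] at h1
    have := le_abs_self (φ g)
    have := neg_abs_le (φ g)
    rcases le_total 0 k with hk0 | hk0
    · have h9 : d 1 (t ^ k.natAbs) + d 1 (t ^ N) ≤ d 1 (t ^ (k.natAbs + N)) + K := ax.add _ _
      have e : (-(N : ℤ) - k).natAbs = k.natAbs + N := by omega
      rw [e] at h7
      rw [abs_le] at h1
      omega
    · have h9 : d 1 (t ^ k.natAbs) + d 1 (t ^ (N - k.natAbs)) ≤
        d 1 (t ^ (k.natAbs + (N - k.natAbs))) + K := ax.add _ _
      have e : (-(N : ℤ) - k).natAbs = N - k.natAbs := by omega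
      rw [Nat.add_sub_cancel' (by omega)] at h9
      rw [e] at h7
      rw [abs_le] at h1
      omega
  refine ⟨fun g => φ g, 4 * δ + 2 * R + K, fun g g' => ?_, fun g => ⟨?_, ?_⟩⟩
  · have : ((|φ (g * g') - φ g - φ g'| : ℤ) : ℝ) ≤ ((4 * δ : ℤ) : ℝ) := by exact_mod_cast hqm g g'
    push_cast at this
    have h1 : (0 : ℝ) ≤ 2 * R + K := by positivity
    linarith
  · have : ((d 1 g : ℤ) : ℝ) ≤ ((|φ g| + (δ + 2 * R + K) : ℤ) : ℝ) := by exact_mod_cast hlo g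
    push_cast at this
    have h1 : (0 : ℝ) ≤ δ := by positivity
    linarith
  · have : ((|φ g| : ℤ) : ℝ) ≤ ((d 1 g + δ : ℤ) : ℝ) := by exact_mod_cast hup g
    push_cast at this
    have h1 : (0 : ℝ) ≤ 3 * δ + 2 * R + K := by positivity
    linarith

theorem abs_le_of_isQuasiLine_of_le {X Y : GenSet G} {φ ψ : G → ℝ} {L M : ℝ}
    (hX : IsQuasiLine X.cayley φ L) (hY : IsQuasiLine Y.cayley ψ M) (h : X ≤ Y) :
    ∃ C, ∀ g, |φ g| ≤ C * |ψ g| + C := by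
  obtain ⟨c, hc⟩ := h
  have hL := hX.one_le
  have hM := hY.one_le
  refine ⟨L * c * M * (|ψ 1| + 1) + |φ 1|, fun g => ?_⟩
  have h1 := hX.abs_sub_le 1 g
  have h2 := hY.dist_le 1 g
  have h3 : (X.cayley.dist 1 g : ℝ) ≤ c * Y.cayley.dist 1 g := by exact_mod_cast hc 1 g
  have h4 : |φ g| ≤ |φ 1| + |φ 1 - φ g| := by
    have := abs_sub_abs_le_abs_sub (φ g) (φ 1)
    rw [abs_sub_comm] at this
    linarith
  have h5 : |ψ 1 - ψ g| ≤ |ψ 1| + |ψ g| := abs_sub _ _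
  have h6 : L * (X.cayley.dist 1 g : ℝ) ≤ L * c * (M * (|ψ 1| + |ψ g|) + M) := by
    rw [mul_assoc]
    refine mul_le_mul_of_nonneg_left (h3.trans (mul_le_mul_of_nonneg_left ?_ (by positivity)))
      (by linarith)
    have := mul_le_mul_of_nonneg_left h5 (by linarith : 0 ≤ M)
    linarith
  have h7 : 0 ≤ L * c * M * |ψ 1| * |ψ g| := by positivity
  have h8 : 0 ≤ |φ 1| * |ψ g| := by positivity
  nlinarith

/-- Two quasimorphisms measuring the word lengths of inequivalent orientable lineal structures are
linearly independent modulo bounded functions. -/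
theorem toClass_eq_of_dependent {X Y : GenSet G} (hX : X.toClass ∈ linealStructures G)
    (hY : Y.toClass ∈ linealStructures G) {φ ψ : G → ℝ} {D E : ℝ}
    (hφ : ∀ g, (X.cayley.dist 1 g : ℝ) ≤ |φ g| + D ∧ |φ g| ≤ X.cayley.dist 1 g + D)
    (hψ : ∀ g, (Y.cayley.dist 1 g : ℝ) ≤ |ψ g| + E ∧ |ψ g| ≤ Y.cayley.dist 1 g + E)
    {a b B : ℝ} (hab : ¬ (a = 0 ∧ b = 0)) (hB : ∀ g, |a * φ g + b * ψ g| ≤ B) :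
    X.toClass = Y.toClass := by
  have main : ∀ {X Y : GenSet G} {φ ψ : G → ℝ} {D E a b B : ℝ}, a ≠ 0 →
      (∀ g, (X.cayley.dist 1 g : ℝ) ≤ |φ g| + D) →
      (∀ g, |ψ g| ≤ Y.cayley.dist 1 g + E) → (∀ g, |a * φ g + b * ψ g| ≤ B) → X ≤ Y := by
    intro X Y φ ψ D E a b B ha h1 h2 h3
    have hB : 0 ≤ B := (abs_nonneg _).trans (h3 1)
    refine GenSet.le_of_coarse_real (|b / a| + (|b / a| * |E| + B / |a| + |D|)) fun g => ?_
    have h4 : |φ g| ≤ B / |a| + |b / a| * |ψ g| := by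
      have e : φ g = (a * φ g + b * ψ g) / a - b / a * ψ g := by field_simp; ring
      have h5 := abs_sub ((a * φ g + b * ψ g) / a) (b / a * ψ g)
      rw [← e, abs_div, abs_mul (b / a)] at h5
      have h6 := div_le_div_of_nonneg_right (h3 g) (abs_nonneg a)
      linarith
    have h5 := mul_le_mul_of_nonneg_left ((h2 g).trans (add_le_add_right (le_abs_self E) _))
      (abs_nonneg (b / a))
    have h6 := h1 g
    have h7 := le_abs_self D
    have h8 : 0 ≤ (|b / a| * |E| + B / |a| + |D|) * (Y.cayley.dist 1 g : ℝ) := by positivity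
    have h9 := abs_nonneg (b / a)
    nlinarith
  -- One domination suffices, because lineal structures form an antichain.
  by_cases ha : a = 0
  · have hb : b ≠ 0 := fun hb => hab ⟨ha, hb⟩
    exact (isAntichain_lineal.eq hY hX (GenSet.toClass_le.2
      (main hb (fun g => (hψ g).1) (fun g => (hφ g).2) (fun g => by
        rw [add_comm]; exact hB g)))).symm
  · exact isAntichain_lineal.eq hX hY (GenSet.toClass_le.2
      (main ha (fun g => (hφ g).1) (fun g => (hψ g).2) hB))

/-- If φ + sψ and φ + rψ defined the same class, they would dominate each other and hence be
proportional modulo bounded functions; independence of φ and ψ then gives s = r. -/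
theorem continuum_le_orientable {A B : GenClass G} (hA : A ∈ orientableLinealStructures G)
    (hB : B ∈ orientableLinealStructures G) (hAB : A ≠ B) :
    Cardinal.continuum ≤ Cardinal.mk (orientableLinealStructures G) := by
  have hA' := orientable_subset_lineal hA
  have hB' := orientable_subset_lineal hB
  obtain ⟨X, rfl, hX, hXc, hXf⟩ := hA
  obtain ⟨Y, rfl, hY, hYc, hYf⟩ := hB
  obtain ⟨φ, D, hφ, hφd⟩ := exists_quasimorphism_of_orientable hX hXc hXf
  obtain ⟨ψ, E, hψ, hψd⟩ := exists_quasimorphism_of_orientable hY hYc hYf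
  have indep : ∀ {a b B : ℝ}, (∀ g, |a * φ g + b * ψ g| ≤ B) → a = 0 ∧ b = 0 := by
    intro a b B h
    by_contra hcon
    exact hAB (toClass_eq_of_dependent hA' hB' hφd hψd hcon h)
  have hub : ∀ s : ℝ, ¬ ∃ B, ∀ g, |φ g + s * ψ g| ≤ B := by
    rintro s ⟨B, hB⟩
    exact one_ne_zero (indep (a := 1) (b := s) (fun g => by rw [one_mul]; exact hB g)).1
  choose Z L hZ hZL using fun s : ℝ => (hφ.add_smul hψ s).exists_orientable (hub s)
  have hinj : Function.Injective fun s : ℝ =>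
      (⟨(Z s).toClass, hZ s⟩ : orientableLinealStructures G) := by
    intro s r hsr
    have hsr : (Z s).toClass = (Z r).toClass := congrArg Subtype.val hsr
    obtain ⟨C, hC⟩ := abs_le_of_isQuasiLine_of_le (hZL s) (hZL r) (GenSet.le_of_toClass_eq hsr)
    obtain ⟨c, B, hc⟩ := (hφ.add_smul hψ r).exists_proportional (hφ.add_smul hψ s) (hub r) hC
    obtain ⟨h1, h2⟩ := indep (a := 1 - c) (b := s - c * r) (B := B) fun g => by
      convert hc g using 2
      ring
    have : c = 1 := by linarith
    rw [this] at h2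
    linarith
  have := Cardinal.lift_mk_le_lift_mk_of_injective hinj
  rwa [Cardinal.mk_real, Cardinal.lift_continuum, Cardinal.lift_uzero] at this

theorem card_orientable : Cardinal.mk (orientableLinealStructures G) = 0 ∨
    Cardinal.mk (orientableLinealStructures G) = 1 ∨
    Cardinal.continuum ≤ Cardinal.mk (orientableLinealStructures G) := by
  rcases Set.eq_empty_or_nonempty (orientableLinealStructures G) with h | ⟨A, hA⟩
  · left
    rw [h]
    simp
  · right
    by_cases hB : ∃ B ∈ orientableLinealStructures G, A ≠ B
    · obtain ⟨B, hB, hne⟩ := hB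
      exact Or.inr (continuum_le_orientable hA hB hne)
    · push Not at hB
      left
      rw [Cardinal.eq_one_iff_unique]
      exact ⟨⟨fun x y => Subtype.ext ((hB x x.2).symm.trans (hB y y.2))⟩, ⟨⟨A, hA⟩⟩⟩

end Busemann

/-! ### Sublinear growth of powers -/

section Growth

variable {G : Type u} [Group G]

/-- Elements whose powers have sublinear length. -/
def HasSublinearGrowth (d : G → G → ℕ) (g : G) : Prop :=
  ∀ c : ℕ, ∃ B, ∀ m : ℕ, c * d 1 (g ^ m) ≤ m + B

namespace HasSublinearGrowth

variable {d : G → G → ℕ}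

theorem one (h : IsInvMetric d) : HasSublinearGrowth d 1 := fun c => ⟨0, fun m => by simp [h.self]⟩

theorem zpow (h : IsInvMetric d) {g : G} (hg : HasSublinearGrowth d g) (k : ℤ) :
    HasSublinearGrowth d (g ^ k) := by
  intro c
  obtain ⟨B, hB⟩ := hg (c * k.natAbs)
  refine ⟨B, fun m => le_trans ?_ (hB m)⟩
  rw [← zpow_natCast, zpow_comm, mul_assoc, zpow_natCast]
  exact Nat.mul_le_mul_left c (h.zpow_le _ k)

theorem mul (h : IsInvMetric d) {a b : G} (hab : Commute a b) (ha : HasSublinearGrowth d a)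
    (hb : HasSublinearGrowth d b) : HasSublinearGrowth d (a * b) := by
  intro c
  obtain ⟨A, hA⟩ := ha (2 * c)
  obtain ⟨B, hB⟩ := hb (2 * c)
  refine ⟨A + B, fun m => ?_⟩
  have h1 := hA m
  have h2 := hB m
  have h3 := Nat.mul_le_mul_left c (h.mul_le (a ^ m) (b ^ m))
  rw [hab.mul_pow]
  rw [mul_assoc] at h1 h2
  rw [mul_add] at h3
  omega

/-- A single n with c·d(1, g^n) < n suffices for each c: divide m by n with remainder. -/
theorem of_not_growth (h : IsInvMetric d) {g : G}
    (hg : ¬ ∃ c : ℕ, ∀ n : ℕ, n ≤ c * d 1 (g ^ n)) : HasSublinearGrowth d g := by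
  intro c
  push Not at hg
  obtain ⟨n, hn⟩ := hg c
  refine ⟨c * (n * d 1 g), fun m => ?_⟩
  have h1 := h.mul_le ((g ^ n) ^ (m / n)) (g ^ (m % n))
  rw [← pow_mul, ← pow_add, Nat.div_add_mod, pow_mul] at h1
  have h2 := h.pow_le (g ^ n) (m / n)
  have h3 := h.pow_le g (m % n)
  have h4 : m % n * d 1 g ≤ n * d 1 g :=
    Nat.mul_le_mul_right _ (Nat.mod_lt _ (by omega)).le
  have h5 : m / n * (c * d 1 (g ^ n)) ≤ m / n * n := Nat.mul_le_mul_left _ hn.le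
  have h6 := Nat.div_mul_le_self m n
  have h7 := Nat.mul_le_mul_left c (h1.trans (Nat.add_le_add h2 (h3.trans h4)))
  have e : c * (m / n * d 1 (g ^ n) + n * d 1 g) =
    m / n * (c * d 1 (g ^ n)) + c * (n * d 1 g) := by ring
  omega

end HasSublinearGrowth

theorem IsQuasiLine.of_equiv {X Y : GenSet G} {φ : G → ℝ} {L : ℝ}
    (h : IsQuasiLine Y.cayley φ L) (hXY : X ≤ Y) (hYX : Y ≤ X) :
    ∃ M, IsQuasiLine X.cayley φ M := by
  obtain ⟨C, hC⟩ := hXY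
  obtain ⟨E, hE⟩ := hYX
  have hL := h.one_le
  have h1 : 0 ≤ C * L := by positivity
  have h2 : 0 ≤ L * E := by positivity
  refine ⟨1 + C * L + L * E, X.connected, by linarith, fun x y hxy => ?_, fun x y => ?_⟩
  · have h3 : (Y.cayley.dist x y : ℝ) ≤ E * X.cayley.dist x y := by exact_mod_cast hE x y
    rw [SimpleGraph.dist_eq_one_iff_adj.2 hxy] at h3
    have h4 := h.abs_sub_le x y
    have h5 := mul_le_mul_of_nonneg_left h3 (by linarith : 0 ≤ L)
    push_cast at h5
    linarith
  · have h3 : (X.cayley.dist x y : ℝ) ≤ C * Y.cayley.dist x y := by exact_mod_cast hC x y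
    have h4 := mul_le_mul_of_nonneg_left (h.dist_le x y) (by positivity : (0 : ℝ) ≤ C)
    have h5 : 0 ≤ (1 + L * E) * |φ x - φ y| := by positivity
    linarith

end Growth

/-! ### Direct sums of infinite dihedral groups -/

section Dihedral

open DihedralGroup

/-- The position of `g • 0` for the action of the infinite dihedral group on the line. -/
def dihedralPos : DihedralGroup 0 → ℤ
  | r a => (show ℤ from a)
  | sr a => -(show ℤ from a)

theorem dihedralPos_inv_mul (g h : DihedralGroup 0) :
    |dihedralPos (g⁻¹ * h)| = |dihedralPos h - dihedralPos g| := by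
  rcases g with a | a <;> rcases h with b | b
  · change |(-(show ℤ from a) + (show ℤ from b))| = |(show ℤ from b) - (show ℤ from a)|
    congr 1; ring
  · change |-((show ℤ from b) - (-(show ℤ from a)))| = |-(show ℤ from b) - (show ℤ from a)|
    congr 1; ring
  · change |-((show ℤ from a) + (show ℤ from b))| = |(show ℤ from b) - -(show ℤ from a)|
    rw [abs_neg]; congr 1; ring
  · change |(show ℤ from b) - (show ℤ from a)| = |-(show ℤ from b) - -(show ℤ from a)|
    rw [← abs_neg]; congr 1; ring

theorem dihedralPos_sr_mul (g : DihedralGroup 0) :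
    dihedralPos (sr 0 * g) = -dihedralPos g := by
  rcases g with a | a
  · change -((0 : ℤ) + (show ℤ from a)) = -(show ℤ from a)
    ring
  · change (show ℤ from a) - (0 : ℤ) = - -(show ℤ from a)
    ring

theorem exists_eq_zpow (x : DihedralGroup 0) :
    x = r 1 ^ dihedralPos x ∨ x = sr 0 * r 1 ^ (-dihedralPos x) := by
  rcases x with a | a
  · left
    rw [r_one_zpow]
    exact congrArg r (Int.cast_id (n := (show ℤ from a))).symm
  · right
    rw [r_one_zpow, sr_mul_r, zero_add]
    refine congrArg sr ?_
    change (show ℤ from a) = ((- -(show ℤ from a) : ℤ) : ℤ)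
    rw [neg_neg]

theorem dihedralPos_zpow (k : ℤ) : dihedralPos (r 1 ^ k) = k := by
  rw [r_one_zpow]
  exact Int.cast_id

variable {I : Type u}

open Classical in
/-- The inclusion of the `i`-th summand. -/
noncomputable def dihedralSingle (i : I) : DihedralGroup 0 →* dihedralSum I :=
  (MonoidHom.mulSingle (fun _ => DihedralGroup 0) i).codRestrict (dihedralSum I) fun x =>
    (Set.finite_singleton i).subset (by
      intro j hj
      by_contra hne
      exact hj (Pi.mulSingle_eq_of_ne (M := fun _ => DihedralGroup 0) hne x))

theorem dihedralSingle_same (i : I) (x : DihedralGroup 0) : (dihedralSingle i x).1 i = x := by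
  classical
  exact Pi.mulSingle_eq_same (M := fun _ => DihedralGroup 0) i x

theorem dihedralSingle_ne {i j : I} (h : j ≠ i) (x : DihedralGroup 0) :
    (dihedralSingle i x).1 j = 1 := by
  classical
  exact Pi.mulSingle_eq_of_ne (M := fun _ => DihedralGroup 0) h x

theorem dihedralSingle_commute {i : I} (x : DihedralGroup 0) {g : dihedralSum I}
    (hg : g.1 i = 1) : Commute (dihedralSingle i x) g := by
  refine Subtype.ext (funext fun j => ?_)
  change (dihedralSingle i x).1 j * g.1 j = g.1 j * (dihedralSingle i x).1 j
  by_cases h : j = i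
  · subst h
    rw [hg, mul_one, one_mul]
  · rw [dihedralSingle_ne h, mul_one, one_mul]

theorem exists_eq_dihedralSingle_mul (i : I) (g : dihedralSum I) :
    ∃ e : dihedralSum I, e.1 i = 1 ∧ (∀ j ≠ i, e.1 j = g.1 j) ∧
      g = dihedralSingle i (g.1 i) * e := by
  refine ⟨(dihedralSingle i (g.1 i))⁻¹ * g, ?_, fun j hj => ?_, by rw [mul_inv_cancel_left]⟩
  · change ((dihedralSingle i (g.1 i)).1 i)⁻¹ * g.1 i = 1
    rw [dihedralSingle_same, inv_mul_cancel]
  · change ((dihedralSingle i (g.1 i)).1 j)⁻¹ * g.1 j = g.1 j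
    rw [dihedralSingle_ne hj, inv_one, one_mul]

theorem dihedralSum_induction {P : dihedralSum I → Prop} (one : P 1)
    (mul : ∀ i x g, g.1 i = 1 → P g → P (dihedralSingle i x * g)) (g : dihedralSum I) : P g := by
  classical
  have key : ∀ F : Finset I, ∀ g : dihedralSum I, (∀ j ∉ F, g.1 j = 1) → P g := by
    intro F
    induction F using Finset.induction_on with
    | empty =>
      intro g hg
      have : g = 1 := Subtype.ext (funext fun j => hg j (Finset.notMem_empty j))
      rw [this]
      exact one
    | insert i F hi ih =>
      intro g hg
      obtain ⟨e, he1, he2, he3⟩ := exists_eq_dihedralSingle_mul i g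
      rw [he3]
      refine mul i _ e he1 (ih e fun j hj => ?_)
      by_cases hji : j = i
      · rw [hji, he1]
      · rw [he2 j hji]
        exact hg j (by simp [hji, hj])
  exact key (Set.Finite.toFinset g.2) g fun j hj => by
    by_contra hne
    exact hj ((Set.Finite.mem_toFinset _).2 hne)

theorem closure_dihedralSum : Subgroup.closure (Set.range (Sum.elim
    (fun i : I => dihedralSingle i (r 1)) fun i => dihedralSingle i (sr 0))) = ⊤ := by
  refine (Subgroup.eq_top_iff' _).2 fun g => ?_
  induction g using dihedralSum_induction with
  | one => exact one_mem _
  | mul i x g _ hg =>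
    refine mul_mem ?_ hg
    have h1 := Subgroup.subset_closure (Set.mem_range_self (f := Sum.elim
      (fun i : I => dihedralSingle i (r 1)) fun i => dihedralSingle i (sr 0)) (Sum.inl i))
    have h2 := Subgroup.subset_closure (Set.mem_range_self (f := Sum.elim
      (fun i : I => dihedralSingle i (r 1)) fun i => dihedralSingle i (sr 0)) (Sum.inr i))
    rcases exists_eq_zpow x with hx | hx
    · rw [hx, map_zpow]
      exact zpow_mem h1 _
    · rw [hx, map_mul, map_zpow]
      exact mul_mem h2 (zpow_mem h1 _)

theorem sublinear_of_rotations {d : dihedralSum I → dihedralSum I → ℕ} (h : IsInvMetric d)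
    (hr : ∀ i, HasSublinearGrowth d (dihedralSingle i (r 1))) (g : dihedralSum I)
    (hg : ∀ i, ∃ k : ℤ, g.1 i = r 1 ^ k) : HasSublinearGrowth d g := by
  induction g using dihedralSum_induction with
  | one => exact HasSublinearGrowth.one h
  | mul i x g hi ih =>
    have hx : ∃ k : ℤ, x = r 1 ^ k := by
      obtain ⟨k, hk⟩ := hg i
      change (dihedralSingle i x).1 i * g.1 i = _ at hk
      rw [dihedralSingle_same, hi, mul_one] at hk
      exact ⟨k, hk⟩
    obtain ⟨k, rfl⟩ := hx
    refine HasSublinearGrowth.mul h (dihedralSingle_commute _ hi) ?_ (ih fun j => ?_)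
    · rw [map_zpow]
      exact (hr i).zpow h k
    · by_cases hj : j = i
      · exact ⟨0, by rw [hj, hi, zpow_zero]⟩
      · obtain ⟨l, hl⟩ := hg j
        change (dihedralSingle i _).1 j * g.1 j = _ at hl
        rw [dihedralSingle_ne hj, one_mul] at hl
        exact ⟨l, hl⟩

theorem mul_self_eq_zpow (x : DihedralGroup 0) : ∃ k : ℤ, x * x = r 1 ^ k := by
  rcases x with a | a
  · refine ⟨(show ℤ from a) + (show ℤ from a), ?_⟩
    rw [r_one_zpow, r_mul_r]
    exact congrArg r (Int.cast_id (n := (show ℤ from a) + (show ℤ from a))).symm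
  · exact ⟨0, by rw [sr_mul_sr, sub_self, zpow_zero]; rfl⟩

/-- If the boundary is not empty, then some coordinate rotation has linear growth. -/
theorem exists_rotation_growth {d : dihedralSum I → dihedralSum I → ℕ} (h : IsInvMetric d)
    {t : dihedralSum I} (ht : ∀ n : ℕ, n ≤ d 1 (t ^ n)) :
    ∃ (i : I) (c : ℕ), ∀ n : ℕ, n ≤ c * d 1 (dihedralSingle i (r 1) ^ n) := by
  by_contra hcon
  push Not at hcon
  -- The square of t is used because all its coordinates are rotations, even where t has
  -- reflections.
  obtain ⟨B, hB⟩ := sublinear_of_rotations h (fun i => HasSublinearGrowth.of_not_growth h (by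
    push Not; exact hcon i)) (t * t) (fun i => mul_self_eq_zpow (t.1 i)) 1
  have h1 := hB (B + 1)
  have h2 := ht (2 * (B + 1))
  rw [← pow_two, ← pow_mul] at h1
  omega

/-- The `i`-th coordinate, as a position on the line. -/
noncomputable def coordPos (i : I) (g : dihedralSum I) : ℝ := dihedralPos (g.1 i)

theorem coordPos_zpow (i : I) (k : ℤ) : coordPos i (dihedralSingle i (r 1) ^ k) = k := by
  unfold coordPos
  rw [← map_zpow, dihedralSingle_same, dihedralPos_zpow]

theorem exists_coord_structures (I : Type u) : ∃ (Y : I → GenSet (dihedralSum I)) (L : I → ℝ),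
    ∀ i, IsQuasiLine (Y i).cayley (coordPos i) (L i) := by
  have key : ∀ i : I, ∃ (Y : GenSet (dihedralSum I)) (L : ℝ),
      IsQuasiLine Y.cayley (coordPos i) L := by
    intro i
    refine exists_isQuasiLine (D := 0) (a := 1) (B := 0) (g₀ := dihedralSingle i (r 1))
      one_pos (fun g h => ?_) fun k => ?_
    · have : |coordPos i (g⁻¹ * h)| = |coordPos i h - coordPos i g| := by
        have := dihedralPos_inv_mul (g.1 i) (h.1 i)
        unfold coordPos
        exact_mod_cast this
      rw [this, sub_self, abs_zero]
    · rw [coordPos_zpow, one_mul, sub_self, abs_zero]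
  choose Y L h using key
  exact ⟨Y, L, h⟩

theorem coordPos_unbounded (i : I) :
    (∀ R, ∃ g, R ≤ coordPos i g) ∧ ∀ R, ∃ g, coordPos i g ≤ R :=
  unbounded_of_slope (a := 1) (B := 0) (g₀ := dihedralSingle i (r 1)) one_pos fun k => by
    rw [coordPos_zpow, one_mul, sub_self, abs_zero]

/-- The word length of a hyperbolic structure with nonempty boundary is controlled by one of the
coordinates. -/
theorem exists_coord_bound {X : GenSet (dihedralSum I)} (hX : IsHyperbolicGraph X.cayley)
    (hne : Nonempty (Boundary X.cayley)) :
    ∃ (i : I) (C : ℕ), ∀ g, X.cayley.dist 1 g ≤ C * (dihedralPos (g.1 i)).natAbs + C := by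
  obtain ⟨δ, hδ⟩ := hX.fourPoint
  have h := X.isHypMetric hδ
  obtain ⟨t₀, ht₀⟩ := X.exists_strong hδ hne
  obtain ⟨i, c, hc⟩ := exists_rotation_growth h.toIsInvMetric (h.isAxial ht₀).le
  obtain ⟨m, -, hm⟩ := exists_pow_displacement δ hc
  set ρ := dihedralSingle i (r 1)
  set σ := dihedralSingle i (sr 0)
  obtain ⟨t, ht, K, ax⟩ : ∃ t, t = ρ ^ m ∧ ∃ K, IsAxial X.cayley.dist t K :=
    ⟨_, rfl, _, h.isAxial hm⟩
  obtain ⟨R, hR⟩ : ∃ R, ∀ g, Commute g t → ∃ k : ℤ, X.cayley.dist g (t ^ k) ≤ R :=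
    ⟨_, fun g hg => h.near_axis_of_commute ax hg⟩
  have hσρ : σ * ρ = ρ⁻¹ * σ := by
    rw [← map_mul, ← map_inv, ← map_mul]
    rfl
  have hσt : ∀ k : ℤ, σ * t ^ k = t ^ (-k) * σ := by
    have h1 : SemiconjBy σ ρ ρ⁻¹ := hσρ
    intro k
    have h2 := (h1.pow_right m).zpow_right k
    rw [inv_pow, inv_zpow', ← ht] at h2
    exact h2
  set S := X.cayley.dist 1 σ
  -- Since e commutes with t, it is R-close to some t^k. Since e also commutes with σ, which inverts
  -- t, the product eσ is R-close to t^(-k)σ. So t^k and t^(-k) are at distance at most 2(R + S),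
  -- which bounds |k|.
  have he : ∀ e : dihedralSum I, e.1 i = 1 →
      X.cayley.dist 1 e ≤ R + (R + S) * X.cayley.dist 1 t := by
    intro e he
    have hce : Commute e t := by
      rw [ht, ← map_pow]
      exact (dihedralSingle_commute _ he).symm
    obtain ⟨k, hk⟩ := hR e hce
    have h1 := h.mul_left σ e (t ^ k)
    rw [hσt, (dihedralSingle_commute (sr 0) he).eq] at h1
    have h2 : X.cayley.dist e (e * σ) = S := by rw [h.eq_one, inv_mul_cancel_left]
    have h3 : X.cayley.dist (t ^ (-k)) (t ^ (-k) * σ) = S := by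
      rw [h.eq_one, inv_mul_cancel_left]
    change X.cayley.dist (e * σ) (t ^ (-k) * σ) = _ at h1
    have h4 := h.tri (t ^ k) e (t ^ (-k))
    have h5 := h.tri e (e * σ) (t ^ (-k))
    have h6 := h.tri (e * σ) (t ^ (-k) * σ) (t ^ (-k))
    have h7 := h.comm (t ^ (-k)) (t ^ (-k) * σ)
    have h8 := h.comm (t ^ k) e
    have h9 := h.zpow_zpow t k (-k)
    have h10 := ax.le (-k - k).natAbs
    have h11 : k.natAbs ≤ R + S := by omega
    have h12 := h.tri 1 (t ^ k) e
    have h13 := h.zpow_le t k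
    have h14 := Nat.mul_le_mul_right (X.cayley.dist 1 t) h11
    omega
  have hrot : ∀ x : DihedralGroup 0, X.cayley.dist 1 (dihedralSingle i x) ≤
      S + (dihedralPos x).natAbs * X.cayley.dist 1 ρ := by
    intro x
    rcases exists_eq_zpow x with hx | hx
    · have h1 := h.zpow_le ρ (dihedralPos x)
      rw [← map_zpow, ← hx] at h1
      omega
    · have h1 := h.zpow_le ρ (-dihedralPos x)
      have h2 := h.mul_le σ (ρ ^ (-dihedralPos x))
      rw [← map_zpow, ← map_mul, ← hx] at h2
      rw [Int.natAbs_neg, ← map_zpow] at h1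
      change X.cayley.dist 1 (dihedralSingle i x) ≤ S + _ at h2
      omega
  refine ⟨i, X.cayley.dist 1 ρ + (S + (R + (R + S) * X.cayley.dist 1 t)), fun g => ?_⟩
  obtain ⟨e, he1, -, he3⟩ := exists_eq_dihedralSingle_mul i g
  have h1 := h.mul_le (dihedralSingle i (g.1 i)) e
  rw [← he3] at h1
  have h2 := he e he1
  have h3 := hrot (g.1 i)
  have h4 := Nat.zero_le ((S + (R + (R + S) * X.cayley.dist 1 t)) * (dihedralPos (g.1 i)).natAbs)
  rw [add_mul]
  rw [mul_comm (dihedralPos _).natAbs] at h3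
  omega

/-- The coordinate bound gives X ≤ Y i, and minimality of the lineal class of Y i turns this into
equality. -/
theorem coord_classification {Y : I → GenSet (dihedralSum I)} {L : I → ℝ}
    (hY : ∀ i, IsQuasiLine (Y i).cayley (coordPos i) (L i)) {X : GenSet (dihedralSum I)}
    (hX : IsHyperbolicGraph X.cayley) (hne : Nonempty (Boundary X.cayley)) :
    ∃ i, X.toClass = (Y i).toClass ∧ ∃ M, IsQuasiLine X.cayley (coordPos i) M := by
  obtain ⟨i, C, hC⟩ := exists_coord_bound hX hne
  obtain ⟨hu, hd⟩ := coordPos_unbounded i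
  have hXY : X ≤ Y i := by
    have hL := (hY i).one_le
    refine GenSet.le_of_coarse_real (C * L i + C) fun g => ?_
    have h1 : (X.cayley.dist 1 g : ℝ) ≤ C * |coordPos i g| + C := by
      have : (X.cayley.dist 1 g : ℝ) ≤ C * ((dihedralPos (g.1 i)).natAbs : ℝ) + C := by
        exact_mod_cast hC g
      rwa [Nat.cast_natAbs, Int.cast_abs] at this
    have h2 := (hY i).abs_sub_le 1 g
    have h3 : coordPos i (1 : dihedralSum I) = 0 := by
      have := coordPos_zpow i 0
      rwa [zpow_zero, Int.cast_zero] at this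
    rw [h3, zero_sub, abs_neg] at h2
    have h4 := mul_le_mul_of_nonneg_left h2 (by positivity : (0 : ℝ) ≤ C)
    have h5 : 0 ≤ C * ((Y i).cayley.dist 1 g : ℝ) := by positivity
    have h6 : 0 ≤ C * L i := by positivity
    linarith
  have hmin := isMinimal_of_lineal (A := (Y i).toClass)
    ⟨Y i, rfl, (hY i).isHyperbolicGraph, (hY i).card_boundary hu hd⟩
  have hYX := hmin.2 (y := X.toClass) ⟨⟨X, rfl, hX⟩, toClass_notMem_elliptic hX hne⟩
    (GenSet.toClass_le.2 hXY)
  exact ⟨i, le_antisymm (GenSet.toClass_le.2 hXY) hYX,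
    (hY i).of_equiv hXY (GenSet.toClass_le.1 hYX)⟩

theorem card_boundary_dihedralSum {X : GenSet (dihedralSum I)} (hX : IsHyperbolicGraph X.cayley)
    (hne : Nonempty (Boundary X.cayley)) : Nat.card (Boundary X.cayley) = 2 := by
  obtain ⟨Y, L, hY⟩ := exists_coord_structures I
  obtain ⟨i, -, M, hM⟩ := coord_classification hY hX hne
  exact hM.card_boundary (coordPos_unbounded i).1 (coordPos_unbounded i).2

theorem mk_lineal_dihedralSum (I : Type u) :
    Cardinal.mk (linealStructures (dihedralSum I)) = Cardinal.mk I := by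
  obtain ⟨Y, L, hY⟩ := exists_coord_structures I
  have hrange : linealStructures (dihedralSum I) = Set.range fun i => (Y i).toClass := by
    ext A
    constructor
    · rintro ⟨X, rfl, hX, hcard⟩
      obtain ⟨i, hi, -⟩ := coord_classification hY hX
        (Nat.card_pos_iff.1 (by rw [hcard]; exact two_pos)).1
      exact ⟨i, hi.symm⟩
    · rintro ⟨i, rfl⟩
      exact ⟨Y i, rfl, (hY i).isHyperbolicGraph,
        (hY i).card_boundary (coordPos_unbounded i).1 (coordPos_unbounded i).2⟩
  rw [hrange]
  refine Cardinal.mk_range_eq _ fun i j hij => ?_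
  by_contra hne
  obtain ⟨C, hC⟩ := abs_le_of_isQuasiLine_of_le (hY i) (hY j) (GenSet.le_of_toClass_eq hij)
  -- Rotations in coordinate i move the i-th line arbitrarily far and leave the j-th position at 0.
  have h1 := hC (dihedralSingle i (r 1) ^ (⌈C⌉ + 1))
  have h2 : coordPos j (dihedralSingle i (r 1) ^ (⌈C⌉ + 1)) = 0 := by
    unfold coordPos
    rw [← map_zpow, dihedralSingle_ne (Ne.symm hne)]
    exact_mod_cast dihedralPos_zpow 0
  rw [coordPos_zpow, h2, abs_zero, mul_zero, zero_add] at h1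
  have h3 := le_abs_self ((⌈C⌉ + 1 : ℤ) : ℝ)
  have h4 := Int.le_ceil C
  push_cast at h1 h3
  linarith

/-- The reflection in coordinate i negates that coordinate, so it sends a sequence tending to one
end of the line to a sequence tending to the other. -/
theorem orientable_dihedralSum (I : Type u) :
    orientableLinealStructures (dihedralSum I) = ∅ := by
  refine Set.eq_empty_of_forall_notMem ?_
  rintro _ ⟨X, rfl, hX, hcard, hfix⟩
  obtain ⟨Y, L, hY⟩ := exists_coord_structures I
  obtain ⟨i, -, M, hM⟩ := coord_classification hY hX
    (Nat.card_pos_iff.1 (by rw [hcard]; exact two_pos)).1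
  obtain ⟨hu, hd⟩ := coordPos_unbounded i
  obtain ⟨x, hx⟩ := IsQuasiLine.exists_tendsto_atTop hu
  have hxx := hM.fellow_of_tendsto hx hx
  obtain ⟨δ, hδ⟩ := hX.fourPoint
  have hf : Fellow X.cayley x (fun n => dihedralSingle i (sr 0) * x n) :=
    (hδ.fellow_of_boundaryPoint_eq (hx := fellow_mul_left X.1 (dihedralSingle i (sr 0)) hxx)
      (hy := hxx) (hfix _ (boundaryPoint hxx))).symm
  refine hM.not_fellow hu hd hx ?_ hf
  refine (Filter.tendsto_neg_atTop_atBot.comp hx).congr fun n => ?_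
  have h1 : dihedralPos ((dihedralSingle i (sr 0) * x n).1 i) = -dihedralPos ((x n).1 i) := by
    rw [← dihedralPos_sr_mul]
    change dihedralPos ((dihedralSingle i (sr 0)).1 i * _) = _
    rw [dihedralSingle_same]
  change -((dihedralPos ((x n).1 i) : ℤ) : ℝ) =
    ((dihedralPos ((dihedralSingle i (sr 0) * x n).1 i) : ℤ) : ℝ)
  rw [h1, Int.cast_neg]

theorem not_infinite_boundary_dihedralSum {X : GenSet (dihedralSum I)}
    (hX : IsHyperbolicGraph X.cayley) : ¬ Infinite (Boundary X.cayley) := by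
  intro hinf
  have h1 := card_boundary_dihedralSum hX inferInstance
  rw [Nat.card_eq_zero_of_infinite] at h1
  exact absurd h1 (by norm_num)

theorem exists_generators_dihedralSum (I : Type u) : ∃ S : Set (dihedralSum I),
    Subgroup.closure S = ⊤ ∧ Cardinal.mk S ≤ 2 * Cardinal.mk I ∧
      (Cardinal.aleph0 ≤ Cardinal.mk I → Cardinal.mk S ≤ Cardinal.mk I) := by
  have h2 : Cardinal.mk (Set.range (Sum.elim
      (fun i : I => dihedralSingle i (r 1)) fun i => dihedralSingle i (sr 0))) ≤
      2 * Cardinal.mk I := by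
    refine Cardinal.mk_range_le.trans ?_
    rw [Cardinal.mk_sum, Cardinal.lift_id, two_mul]
  refine ⟨_, closure_dihedralSum, h2, fun h => h2.trans ?_⟩
  exact (Cardinal.mul_eq_right h ((Cardinal.ofNat_lt_aleph0 (n := 2)).le.trans h)
    two_ne_zero).le

end Dihedral

end HypStr

theorem mainTheorem2 :
    (∀ (G : Type u) [Group G],
      IsAntichain (· ≤ ·) (HypStr.linealStructures G) ∧
      IsAntichain (· ≤ ·) (HypStr.orientableLinealStructures G) ∧
      (∀ A ∈ HypStr.linealStructures G, HypStr.IsMinimalStructure G A) ∧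
      (Cardinal.mk (HypStr.orientableLinealStructures G) = 0 ∨
        Cardinal.mk (HypStr.orientableLinealStructures G) = 1 ∨
        Cardinal.continuum ≤ Cardinal.mk (HypStr.orientableLinealStructures G))) ∧
    (∀ (κ : Cardinal.{u}) (I : Type u), Cardinal.mk I = κ →
      Cardinal.mk (HypStr.linealStructures (HypStr.dihedralSum I)) = κ ∧
      HypStr.orientableLinealStructures (HypStr.dihedralSum I) = ∅ ∧
      HypStr.quasiParabolicStructures (HypStr.dihedralSum I) = ∅ ∧
      HypStr.generalTypeStructures (HypStr.dihedralSum I) = ∅ ∧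
      (∃ S : Set (HypStr.dihedralSum I), Subgroup.closure S = ⊤ ∧
        Cardinal.mk S ≤ 2 * κ ∧ (Cardinal.aleph0 ≤ κ → Cardinal.mk S ≤ κ)) ∧
      (κ < Cardinal.aleph0 → Group.FG (HypStr.dihedralSum I))) := by
  refine ⟨fun G _ => ⟨HypStr.isAntichain_lineal,
    HypStr.isAntichain_lineal.subset HypStr.orientable_subset_lineal,
    fun A hA => HypStr.isMinimal_of_lineal hA, HypStr.card_orientable⟩, ?_⟩
  rintro _ I rfl
  refine ⟨HypStr.mk_lineal_dihedralSum I, HypStr.orientable_dihedralSum I, ?_, ?_,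
    HypStr.exists_generators_dihedralSum I, fun h => ?_⟩
  · refine Set.eq_empty_of_forall_notMem ?_
    rintro _ ⟨X, -, hX, hinf, -⟩
    exact HypStr.not_infinite_boundary_dihedralSum hX hinf
  · refine Set.eq_empty_of_forall_notMem ?_
    rintro _ ⟨X, -, hX, hinf, -⟩
    exact HypStr.not_infinite_boundary_dihedralSum hX hinf
  · have : Finite I := Cardinal.lt_aleph0_iff_finite.1 h
    exact Group.fg_iff.2 ⟨_, HypStr.closure_dihedralSum, Set.finite_range _⟩
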